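/- Let $N$ be an integer with $3\le N\le 9$, let $B_1$ be the open unit ball of $\mathbb{R}^N$, and let $1\le q<p\le\infty$ with $p>\frac{N}{N-2}$. Then there exist functions $u_n\in C^\infty(\overline{B_1})$ and $f_n\in C^\infty(\mathbb{R})$, $n\in\mathbb{N}$, such that for every $n$: $u_n$ is radial; $f_n$ is nonnegative and nondecreasing on $\mathbb{R}$; $-\Delta u_n=f_n(u_n)$ in $B_1$ and $u_n=0$ on $\partial B_1$; and $u_n$ has radial Morse index $1$, that is, $1$ is the maximal dimension of a linear subspace $X$ of the space of radial $C^1$ functions with compact support in $B_1$ such that $$\int_{B_1}\left(|\nabla\varphi|^2-f_n'(u_n)\,\varphi^2\right)dx<0\qquad\text{for all }\varphi\in X\setminus\{0\};$$ and such that $$\frac{\|u_n\|_{L^p(B_1)}}{\|u_n\|_{L^q(B_1)}}\longrightarrow+\infty\qquad\text{as }n\to\infty.$$ -/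

import Mathlib

open MeasureTheory Filter Topology Metric Set
open scoped ContDiff ENNReal

noncomputable section

namespace RadialMorse

/-- `-Δu = f(u)` in `Ω` and `u = 0` on `∂Ω`, pointwise. The Laplacian in the open set `Ω` is the
classical one as soon as `u` is `C²` there, which is required separately wherever this is used. -/
def SolvesDirichlet {N : ℕ} (Ω : Set (EuclideanSpace ℝ (Fin N))) (f : ℝ → ℝ)
    (u : EuclideanSpace ℝ (Fin N) → ℝ) : Prop :=
  (∀ x ∈ Ω, -(Laplacian.laplacian u x) = f (u x)) ∧ ∀ x ∈ frontier Ω, u x = 0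

/-- `u` is a function of `|x|` on the set `s`. -/
def IsRadialOn {N : ℕ} (u : EuclideanSpace ℝ (Fin N) → ℝ)
    (s : Set (EuclideanSpace ℝ (Fin N))) : Prop :=
  ∀ x ∈ s, ∀ y ∈ s, ‖x‖ = ‖y‖ → u x = u y

/-- The space of radial `C¹` functions with compact support contained in `Ω`
(extended by zero to the whole space). -/
def radialTestSpace {N : ℕ} (Ω : Set (EuclideanSpace ℝ (Fin N))) :
    Submodule ℝ (EuclideanSpace ℝ (Fin N) → ℝ) where
  carrier := {φ | ContDiff ℝ 1 φ ∧ HasCompactSupport φ ∧ tsupport φ ⊆ Ω ∧ IsRadialOn φ univ}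
  zero_mem' := by
    refine ⟨contDiff_const, HasCompactSupport.zero, ?_, fun _ _ _ _ _ => rfl⟩
    simp [tsupport]
  add_mem' := by
    rintro φ ψ ⟨h1, h2, h3, h4⟩ ⟨k1, k2, k3, k4⟩
    refine ⟨h1.add k1, h2.add k2, (tsupport_add φ ψ).trans (union_subset h3 k3), ?_⟩
    intro x hx y hy hxy
    simp only [Pi.add_apply]
    rw [h4 x hx y hy hxy, k4 x hx y hy hxy]
  smul_mem' := by
    rintro c φ ⟨h1, h2, h3, h4⟩
    have hs : tsupport (c • φ) ⊆ tsupport φ :=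
      closure_mono (Function.support_const_smul_subset c φ)
    refine ⟨contDiff_const.smul h1, h2.mono' (subset_closure.trans hs), hs.trans h3, ?_⟩
    intro x hx y hy hxy
    simp only [Pi.smul_apply]
    rw [h4 x hx y hy hxy]

/-- The second variation `∫_Ω |∇φ|² - f'(u) φ²` of the energy at `u`. -/
def secondVariation {N : ℕ} (Ω : Set (EuclideanSpace ℝ (Fin N))) (f : ℝ → ℝ)
    (u φ : EuclideanSpace ℝ (Fin N) → ℝ) : ℝ :=
  ∫ x in Ω, (‖gradient φ x‖ ^ 2 - deriv f (u x) * φ x ^ 2)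

/-- The radial Morse index of `u` in `Ω` is `k`: the number `k` is the maximal dimension of a
subspace of radial test functions on which the second variation is negative definite. (If there
were such an infinite-dimensional subspace, then there would be finite-dimensional ones of every
dimension, and no `k` would qualify.) -/
def HasRadialMorseIndex {N : ℕ} (Ω : Set (EuclideanSpace ℝ (Fin N))) (f : ℝ → ℝ)
    (u : EuclideanSpace ℝ (Fin N) → ℝ) (k : ℕ) : Prop :=
  IsGreatest {d : ℕ | ∃ X : Submodule ℝ (EuclideanSpace ℝ (Fin N) → ℝ),
    X ≤ radialTestSpace Ω ∧ FiniteDimensional ℝ X ∧ Module.finrank ℝ X = d ∧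
    ∀ φ ∈ X, φ ≠ 0 → secondVariation Ω f u φ < 0} k

/-- The norm of `L^p(Ω)`, `1 ≤ p ≤ ∞`, with respect to Lebesgue measure. -/
def normLp {N : ℕ} (p : ℝ≥0∞) (Ω : Set (EuclideanSpace ℝ (Fin N)))
    (u : EuclideanSpace ℝ (Fin N) → ℝ) : ℝ :=
  (eLpNorm u p (volume.restrict Ω)).toReal

end RadialMorse

end

noncomputable section

namespace RadialMorse

/-! Write N = d + 2. Instead of prescribing f, prescribe the source: let u solve -Δu = k(|x|²),
where k is a smooth step falling from 1 to 0 on the thin shell b < |x| < ε. Then u = P(|x|²) with P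
strictly decreasing, so k = f ∘ P for a nondecreasing f ≥ 0, which is smooth because P' never
vanishes. The linearized potential V = f'(u) lives on the shell, and r^(d+1) V is -(k(r²))' times a
factor that is nearly constant there (`pow_mul_potential`): V acts almost like a point mass of size
(d+2) ε^d at r = ε.

Index at least 1: a cutoff equal to 1 on the ball of radius ε and vanishing near the unit sphere
costs, at best, about d ε^d in Dirichlet energy, less than the gain (d+2) ε^d. A cubic step of u is
C¹ and loses only a factor 6/5, which is affordable for d ≤ 7 (`radial_energy_neg`).

Index at most 1: a radial function vanishing at r = ε hardly sees the mass, and a Riccati multiplier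
makes its second variation nonnegative (`riccati`). Vanishing there is one linear condition, so no
two-dimensional negative space exists (`hasRadialMorseIndex_one`).

Norms: u is at least a constant times ε² on the ball of radius ε and at most a constant times ε² (1
+ |x|/ε)^(-d). Choose r with max(q, N/(N-2)) < r < p. The L^p norm is at least of order ε^(2+N/p),
while the L^q norm is bounded through the L^r norm by order ε^(2+N/r); the ratio blows up as ε → 0
(`exists_rpow_le_normLp_div`). -/

/-- A smooth nonincreasing step, equal to `1` up to `b ^ 2` and to `0` from `ε ^ 2` on. -/
structure IsStep (k : ℝ → ℝ) (b ε : ℝ) : Prop where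
  smooth : ContDiff ℝ ∞ k
  anti : Antitone k
  eq_one : ∀ ρ, ρ ≤ b ^ 2 → k ρ = 1
  eq_zero : ∀ ρ, ε ^ 2 ≤ ρ → k ρ = 0

theorem exists_isStep {b ε : ℝ} (hb : 0 ≤ b) (hbε : b < ε) : ∃ k, IsStep k b ε := by
  have h : 0 < ε ^ 2 - b ^ 2 := by nlinarith
  refine ⟨fun ρ => Real.smoothTransition ((ε ^ 2 - ρ) / (ε ^ 2 - b ^ 2)), ?_, ?_, ?_, ?_⟩
  · exact Real.smoothTransition.contDiff.comp ((contDiff_const.sub contDiff_id).div_const _)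
  · intro x y hxy
    exact Real.smoothTransition.monotone (by gcongr)
  · intro ρ hρ
    exact Real.smoothTransition.one_of_one_le (by rw [le_div_iff₀ h]; linarith)
  · intro ρ hρ
    exact Real.smoothTransition.zero_of_nonpos (div_nonpos_of_nonpos_of_nonneg (by linarith) h.le)

/-! ### Radial means and fluxes of a source -/

/-- The mean `∫₀¹ τ ^ j k(ρ τ²) dτ`. -/
def radialMean (j : ℕ) (k : ℝ → ℝ) (ρ : ℝ) : ℝ := ∫ τ in (0 : ℝ)..1, τ ^ j * k (ρ * τ ^ 2)

theorem hasDerivAt_radialMean (j : ℕ) {k : ℝ → ℝ} (hk : ContDiff ℝ 1 k) (ρ : ℝ) :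
    HasDerivAt (radialMean j k) (radialMean (j + 2) (deriv k) ρ) ρ := by
  have hc : Continuous k := hk.continuous
  have hc' : Continuous (deriv k) := hk.continuous_deriv le_rfl
  obtain ⟨C, hC⟩ := (isCompact_Icc (a := -(|ρ| + 1)) (b := |ρ| + 1)).exists_bound_of_continuousOn
    hc'.continuousOn
  have hC0 : 0 ≤ C := (norm_nonneg _).trans (hC 0 ⟨by linarith [abs_nonneg ρ], by positivity⟩)
  refine (intervalIntegral.hasDerivAt_integral_of_dominated_loc_of_deriv_le
    (F := fun ρ τ => τ ^ j * k (ρ * τ ^ 2)) (F' := fun ρ τ => τ ^ (j + 2) * deriv k (ρ * τ ^ 2))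
    (bound := fun _ => C) (s := ball ρ 1) (ball_mem_nhds _ one_pos) ?_ ?_ ?_ ?_ ?_ ?_).2
  · exact Eventually.of_forall fun x => (by fun_prop : Continuous _).aestronglyMeasurable
  · exact (by fun_prop : Continuous _).intervalIntegrable _ _
  · exact (by fun_prop : Continuous _).aestronglyMeasurable
  · refine Eventually.of_forall fun τ hτ x hx => ?_
    rw [uIoc_of_le zero_le_one] at hτ
    have hx' : |x| ≤ |ρ| + 1 := by
      rw [mem_ball, Real.dist_eq] at hx
      have := abs_sub_abs_le_abs_sub x ρ
      linarith
    have ht : τ ^ 2 ≤ 1 := pow_le_one₀ hτ.1.le hτ.2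
    have hxt : |x * τ ^ 2| ≤ |ρ| + 1 := by
      rw [abs_mul, abs_of_nonneg (sq_nonneg τ)]
      exact (mul_le_of_le_one_right (abs_nonneg _) ht).trans hx'
    rw [norm_mul, norm_pow, Real.norm_of_nonneg hτ.1.le]
    have h1 := hC _ (abs_le.1 hxt)
    have h2 : τ ^ (j + 2) ≤ 1 := pow_le_one₀ hτ.1.le hτ.2
    calc _ ≤ 1 * C := by gcongr
      _ = C := one_mul C
  · exact intervalIntegrable_const
  · refine Eventually.of_forall fun τ _ x _ => ?_
    have h1 : HasDerivAt k (deriv k (x * τ ^ 2)) (x * τ ^ 2) :=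
      (hk.differentiable one_ne_zero _).hasDerivAt
    have h2 : HasDerivAt (fun x : ℝ => x * τ ^ 2) (τ ^ 2) x := by
      simpa using (hasDerivAt_id x).mul_const (τ ^ 2)
    exact ((h1.comp x h2).const_mul (τ ^ j)).congr_deriv (by ring)

/-- Differentiating in ρ yields another radial mean, of `deriv k` with exponent j + 2, so the
induction must run over all `j` and `k` at once. -/
theorem contDiff_radialMean {k : ℝ → ℝ} (hk : ContDiff ℝ ∞ k) (j : ℕ) :
    ContDiff ℝ ∞ (radialMean j k) := by
  refine contDiff_infty.2 fun n => ?_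
  induction n generalizing j k with
  | zero =>
    exact contDiff_zero.2 (continuous_iff_continuousAt.2 fun ρ =>
      (hasDerivAt_radialMean j (hk.of_le (by simp)) ρ).continuousAt)
  | succ n ih =>
    have hd := fun ρ => hasDerivAt_radialMean j (hk.of_le (by simp)) ρ
    rw [Nat.cast_succ, contDiff_succ_iff_deriv]
    refine ⟨fun ρ => (hd ρ).differentiableAt, by simp, ?_⟩
    rw [funext fun ρ => (hd ρ).deriv]
    exact ih (contDiff_infty_iff_deriv.1 hk).2 (j + 2)

/-- Integrate the τ-derivative of τ^(j+1) k(ρτ²) over [0, 1]. For j = d + 1 this is the radial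
Poisson equation in the variable ρ. -/
theorem radialMean_euler {k : ℝ → ℝ} (hk : ContDiff ℝ 1 k) (j : ℕ) (ρ : ℝ) :
    2 * ρ * radialMean (j + 2) (deriv k) ρ + (j + 1) * radialMean j k ρ = k ρ := by
  have hc : Continuous k := hk.continuous
  have hc' : Continuous (deriv k) := hk.continuous_deriv le_rfl
  have h : ∫ τ in (0 : ℝ)..1,
      (2 * ρ * (τ ^ (j + 2) * deriv k (ρ * τ ^ 2)) + (j + 1) * (τ ^ j * k (ρ * τ ^ 2)))
      = 1 ^ (j + 1) * k (ρ * 1 ^ 2) - 0 ^ (j + 1) * k (ρ * 0 ^ 2) := by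
    refine intervalIntegral.integral_eq_sub_of_hasDerivAt
      (f := fun τ => τ ^ (j + 1) * k (ρ * τ ^ 2)) (fun τ _ => ?_) ?_
    · have h1 : HasDerivAt k (deriv k (ρ * τ ^ 2)) (ρ * τ ^ 2) :=
        (hk.differentiable one_ne_zero _).hasDerivAt
      have h2 : HasDerivAt (fun τ : ℝ => ρ * τ ^ 2) (ρ * (2 * τ)) τ := by
        simpa using (hasDerivAt_pow 2 τ).const_mul ρ
      refine ((hasDerivAt_pow (j + 1) τ).mul (h1.comp τ h2)).congr_deriv ?_
      simp only [Nat.cast_add, Nat.cast_one, Nat.add_sub_cancel, Function.comp]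
      ring
    · exact (by fun_prop : Continuous _).intervalIntegrable _ _
  rw [intervalIntegral.integral_add, intervalIntegral.integral_const_mul,
    intervalIntegral.integral_const_mul] at h
  · simpa [radialMean] using h
  · exact (by fun_prop : Continuous _).intervalIntegrable _ _
  · exact (by fun_prop : Continuous _).intervalIntegrable _ _

/-- The flux `∫₀ʳ s ^ j k(s²) ds` of a radial source. -/
def flux (j : ℕ) (k : ℝ → ℝ) (r : ℝ) : ℝ := ∫ s in (0 : ℝ)..r, s ^ j * k (s ^ 2)

/-- Substitution s = rτ. The mean is the form that is smooth across the origin; the flux is the form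
that is easy to estimate. -/
theorem pow_mul_radialMean (j : ℕ) (k : ℝ → ℝ) (r : ℝ) :
    r ^ (j + 1) * radialMean j k (r ^ 2) = flux j k r := by
  have h := intervalIntegral.mul_integral_comp_mul_left (a := 0) (b := 1)
    (f := fun s : ℝ => s ^ j * k (s ^ 2)) r
  rw [mul_zero, mul_one] at h
  rw [flux, ← h, radialMean, pow_succ, mul_comm (r ^ j), mul_assoc,
    ← intervalIntegral.integral_const_mul]
  congr 2
  ext τ
  simp only [mul_pow]
  ring

theorem hasDerivAt_flux (j : ℕ) {k : ℝ → ℝ} (hk : Continuous k) (r : ℝ) :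
    HasDerivAt (flux j k) (r ^ j * k (r ^ 2)) r :=
  intervalIntegral.integral_hasDerivAt_right
    ((by fun_prop : Continuous _).intervalIntegrable _ _)
    (by fun_prop : Continuous _).stronglyMeasurable.stronglyMeasurableAtFilter
    (by fun_prop : Continuous _).continuousAt

/-! ### Flux bounds for a step source -/

namespace IsStep

variable {k : ℝ → ℝ} {b ε : ℝ} (hk : IsStep k b ε)
include hk

theorem nonneg (ρ : ℝ) : 0 ≤ k ρ := by
  rw [← hk.eq_zero (max ρ (ε ^ 2)) (le_max_right _ _)]
  exact hk.anti (le_max_left _ _)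

theorem le_one (ρ : ℝ) : k ρ ≤ 1 := by
  rw [← hk.eq_one (min ρ (b ^ 2)) (min_le_right _ _)]
  exact hk.anti (min_le_left _ _)

theorem deriv_nonpos (ρ : ℝ) : deriv k ρ ≤ 0 := hk.anti.deriv_nonpos

theorem hasDerivAt (ρ : ℝ) : HasDerivAt k (deriv k ρ) ρ :=
  (hk.smooth.differentiable (by simp) ρ).hasDerivAt

theorem flux_mono (j : ℕ) {r s : ℝ} (hr : 0 ≤ r) (hrs : r ≤ s) : flux j k r ≤ flux j k s := by
  have hc := hk.smooth.continuous
  refine monotoneOn_of_hasDerivWithinAt_nonneg (convex_Ici (0 : ℝ))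
    (fun x _ => (hasDerivAt_flux j hc x).continuousAt.continuousWithinAt)
    (fun x _ => (hasDerivAt_flux j hc x).hasDerivWithinAt) (fun x hx => ?_) hr (hr.trans hrs) hrs
  rw [interior_Ici, mem_Ioi] at hx
  exact mul_nonneg (by positivity) (hk.nonneg _)

theorem flux_of_le (j : ℕ) {r : ℝ} (hr : 0 ≤ r) (hrb : r ≤ b) :
    flux j k r = r ^ (j + 1) / (j + 1) := by
  rw [flux, intervalIntegral.integral_congr (g := fun s => s ^ j)]
  · rw [integral_pow]; simp
  · intro s hs
    rw [uIcc_of_le hr] at hs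
    simp only
    rw [hk.eq_one _ (by gcongr; exacts [hs.1, hs.2.trans hrb]), mul_one]

theorem flux_of_ge (j : ℕ) (hε : 0 ≤ ε) {r : ℝ} (hr : ε ≤ r) : flux j k r = flux j k ε := by
  have hc := hk.smooth.continuous
  have h : flux j k r - flux j k ε = ∫ s in ε..r, s ^ j * k (s ^ 2) :=
    intervalIntegral.integral_interval_sub_left
      ((by fun_prop : Continuous _).intervalIntegrable _ _)
      ((by fun_prop : Continuous _).intervalIntegrable _ _)
  rw [intervalIntegral.integral_congr (g := fun _ => 0)] at h
  · simpa [sub_eq_zero] using h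
  · intro s hs
    rw [uIcc_of_le hr] at hs
    simp only
    rw [hk.eq_zero _ (by gcongr; exact hs.1), mul_zero]

theorem flux_le (j : ℕ) {r : ℝ} (hr : 0 ≤ r) : flux j k r ≤ r ^ (j + 1) / (j + 1) := by
  have hc := hk.smooth.continuous
  have h : ∫ s in (0 : ℝ)..r, s ^ j = r ^ (j + 1) / (j + 1) := by rw [integral_pow]; simp
  rw [flux, ← h]
  refine intervalIntegral.integral_mono_on hr
    ((by fun_prop : Continuous _).intervalIntegrable _ _)
    ((by fun_prop : Continuous _).intervalIntegrable _ _) fun s hs => ?_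
  exact mul_le_of_le_one_right (pow_nonneg hs.1 _) (hk.le_one _)

theorem flux_le_top (j : ℕ) (hε : 0 ≤ ε) {r : ℝ} (hr : 0 ≤ r) :
    flux j k r ≤ ε ^ (j + 1) / (j + 1) := by
  refine (hk.flux_mono j hr (le_max_left r ε)).trans ?_
  rw [hk.flux_of_ge j hε (le_max_right r ε)]
  exact hk.flux_le j hε

theorem le_flux (j : ℕ) (hb : 0 ≤ b) {r : ℝ} (hr : b ≤ r) : b ^ (j + 1) / (j + 1) ≤ flux j k r := by
  rw [← hk.flux_of_le j hb le_rfl]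
  exact hk.flux_mono j hb hr

theorem radialMean_of_nonpos (j : ℕ) {ρ : ℝ} (hρ : ρ ≤ 0) : radialMean j k ρ = 1 / (j + 1) := by
  rw [radialMean, intervalIntegral.integral_congr (g := fun s => s ^ j)]
  · rw [integral_pow]; simp
  · intro s hs
    simp only
    rw [hk.eq_one _ ((mul_nonpos_of_nonpos_of_nonneg hρ (sq_nonneg _)).trans (sq_nonneg _)),
      mul_one]

theorem radialMean_pos (j : ℕ) (hb : 0 < b) (ρ : ℝ) : 0 < radialMean j k ρ := by
  rcases le_or_gt ρ 0 with hρ | hρ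
  · rw [hk.radialMean_of_nonpos j hρ]; positivity
  · have hr : 0 < √ρ := Real.sqrt_pos.2 hρ
    have h := pow_mul_radialMean j k (√ρ)
    rw [Real.sq_sqrt hρ.le] at h
    have h2 : 0 < flux j k (√ρ) := by
      rcases le_total (√ρ) b with h1 | h1
      · rw [hk.flux_of_le j hr.le h1]; positivity
      · exact lt_of_lt_of_le (by positivity) (hk.le_flux j hb.le h1)
    rw [← h] at h2
    exact pos_of_mul_pos_right h2 (by positivity)

end IsStep

/-! ### The profile and its nonlinearity -/

/-- The profile in the variable `ρ = |x|²` of the radial solution of `-Δu = k(|x|²)` in dimension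
`d + 2` which vanishes for `ρ = 1`. -/
def profile (d : ℕ) (k : ℝ → ℝ) (ρ : ℝ) : ℝ := ∫ s in (1 : ℝ)..ρ, -(radialMean (d + 1) k s / 2)

/-- The nonlinearity `f` such that `f (profile d k ρ) = k ρ`. -/
def nonlinearity (d : ℕ) (k : ℝ → ℝ) (ε t : ℝ) : ℝ :=
  open Classical in
  if t < profile d k (ε ^ 2) then 0 else k (Function.invFun (profile d k) t)

theorem profile_one (d : ℕ) (k : ℝ → ℝ) : profile d k 1 = 0 := intervalIntegral.integral_same

namespace IsStep

variable {k : ℝ → ℝ} {b ε : ℝ} (hk : IsStep k b ε) (d : ℕ)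
include hk

theorem hasDerivAt_profile (ρ : ℝ) :
    HasDerivAt (profile d k) (-(radialMean (d + 1) k ρ / 2)) ρ := by
  have hc : Continuous (radialMean (d + 1) k) := (contDiff_radialMean hk.smooth _).continuous
  exact intervalIntegral.integral_hasDerivAt_right
    ((by fun_prop : Continuous _).intervalIntegrable _ _)
    (by fun_prop : Continuous _).stronglyMeasurable.stronglyMeasurableAtFilter
    (by fun_prop : Continuous _).continuousAt

theorem contDiff_profile : ContDiff ℝ ∞ (profile d k) := by
  rw [contDiff_infty_iff_deriv]
  refine ⟨fun ρ => (hk.hasDerivAt_profile d ρ).differentiableAt, ?_⟩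
  rw [funext fun ρ => (hk.hasDerivAt_profile d ρ).deriv]
  exact ((contDiff_radialMean hk.smooth _).div_const _).neg

theorem profile_strictAnti (hb : 0 < b) : StrictAnti (profile d k) :=
  strictAnti_of_hasDerivAt_neg (hk.hasDerivAt_profile d) fun ρ => by
    have := hk.radialMean_pos (d + 1) hb ρ
    linarith

theorem profile_of_nonpos {ρ : ℝ} (hρ : ρ ≤ 0) :
    profile d k ρ = profile d k 0 - ρ / (2 * (d + 2)) := by
  have hc : Continuous (radialMean (d + 1) k) := (contDiff_radialMean hk.smooth _).continuous
  have h : profile d k 0 - profile d k ρ = ∫ s in ρ..0, -(radialMean (d + 1) k s / 2) :=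
    intervalIntegral.integral_interval_sub_left
      ((by fun_prop : Continuous _).intervalIntegrable _ _)
      ((by fun_prop : Continuous _).intervalIntegrable _ _)
  rw [intervalIntegral.integral_congr (g := fun _ => -(1 / ((d : ℝ) + 2) / 2))] at h
  · rw [intervalIntegral.integral_const, smul_eq_mul] at h
    have : ρ / (2 * ((d : ℝ) + 2)) = -((0 - ρ) * -(1 / ((d : ℝ) + 2) / 2)) * -1 := by
      field_simp; ring
    rw [this]; linarith
  · intro s hs
    rw [uIcc_of_le hρ] at hs
    simp only
    rw [hk.radialMean_of_nonpos (d + 1) hs.2]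
    push_cast
    rw [show (d : ℝ) + 1 + 1 = d + 2 by ring]

/-- For negative ρ the profile is affine and unbounded above. Continuing it past the centre ρ = 0 is
what defines f above the maximum of u. -/
theorem mem_range_profile {ρ t : ℝ} (ht : profile d k ρ ≤ t) : t ∈ range (profile d k) := by
  have hc := (hk.contDiff_profile d).continuous
  have hd : (0 : ℝ) < 2 * (d + 2) := by positivity
  set σ : ℝ := min 0 (2 * (d + 2) * (profile d k 0 - t)) with hσ
  have h1 : t ≤ profile d k σ := by
    rw [hk.profile_of_nonpos d (min_le_left _ _)]
    have : σ / (2 * (d + 2)) ≤ profile d k 0 - t := by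
      rw [div_le_iff₀ hd, mul_comm]; exact min_le_right _ _
    linarith
  exact mem_range_of_exists_le_of_exists_ge hc ⟨ρ, ht⟩ ⟨σ, h1⟩

/-- The two branches are consistent: values of P below P(ε²) come from ρ > ε², where k already
vanishes. -/
theorem nonlinearity_profile (hb : 0 < b) (ρ : ℝ) :
    nonlinearity d k ε (profile d k ρ) = k ρ := by
  have hP := hk.profile_strictAnti d hb
  unfold nonlinearity
  split_ifs with h
  · rw [hP.lt_iff_gt] at h
    exact (hk.eq_zero _ h.le).symm
  · rw [Function.leftInverse_invFun hP.injective]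

theorem nonlinearity_nonneg (t : ℝ) : 0 ≤ nonlinearity d k ε t := by
  unfold nonlinearity
  split_ifs
  exacts [le_rfl, hk.nonneg _]

theorem nonlinearity_mono (hb : 0 < b) : Monotone (nonlinearity d k ε) := by
  intro s t hst
  have hP := hk.profile_strictAnti d hb
  rcases lt_or_ge s (profile d k (ε ^ 2)) with h | h
  · rw [nonlinearity, if_pos h]
    exact hk.nonlinearity_nonneg d t
  · obtain ⟨x, rfl⟩ := hk.mem_range_profile d h
    obtain ⟨y, rfl⟩ := hk.mem_range_profile d (h.trans hst)
    rw [hk.nonlinearity_profile d hb, hk.nonlinearity_profile d hb]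
    exact hk.anti (hP.le_iff_ge.1 hst)

/-- Below P(ε²) the function is locally zero. Every other point lies in the open range of P, on
which f is k composed with the inverse of P, smooth since P' < 0. -/
theorem contDiff_nonlinearity (hb : 0 < b) : ContDiff ℝ ∞ (nonlinearity d k ε) := by
  have hP := hk.profile_strictAnti d hb
  have hc := (hk.contDiff_profile d).continuous
  rw [contDiff_iff_contDiffAt]
  intro t
  rcases lt_or_ge t (profile d k (ε ^ 2)) with h | h
  · refine (contDiffAt_const (c := (0 : ℝ))).congr_of_eventuallyEq ?_
    filter_upwards [Iio_mem_nhds h] with s hs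
    exact if_pos hs
  · obtain ⟨x, rfl⟩ := hk.mem_range_profile d h
    have hopen : IsOpenEmbedding (profile d k) := by
      refine .of_continuous_injective_isOpenMap hc hP.injective ?_
      exact isOpenMap_iff_nhds_le.2 fun ρ => by
        have hs : HasStrictDerivAt (profile d k) (-(radialMean (d + 1) k ρ / 2)) ρ :=
          (hk.contDiff_profile d).contDiffAt.hasStrictDerivAt' (hk.hasDerivAt_profile d ρ) (by simp)
        exact (hs.map_nhds_eq (by have := hk.radialMean_pos (d + 1) hb ρ; linarith)).ge
    have hsymm := (hopen.toOpenPartialHomeomorph (profile d k)).contDiffAt_symm_deriv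
      (a := profile d k x) (f₀' := -(radialMean (d + 1) k x / 2)) (n := ∞)
      (by have := hk.radialMean_pos (d + 1) hb x; linarith) (by simp)
      (by simpa [hopen.toOpenPartialHomeomorph_left_inv] using hk.hasDerivAt_profile d x)
      (by simpa using (hk.contDiff_profile d).contDiffAt)
    refine (hk.smooth.contDiffAt.comp _ hsymm).congr_of_eventuallyEq ?_
    filter_upwards [hopen.isOpen_range.mem_nhds (mem_range_self x)] with s hs
    obtain ⟨y, rfl⟩ := hs
    rw [hk.nonlinearity_profile d hb, Function.comp_apply,
      hopen.toOpenPartialHomeomorph_left_inv]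

theorem deriv_nonlinearity_profile (hb : 0 < b) (ρ : ℝ) :
    deriv (nonlinearity d k ε) (profile d k ρ) = -2 * deriv k ρ / radialMean (d + 1) k ρ := by
  have h1 := (((hk.contDiff_nonlinearity d hb).differentiable (by simp)
    (profile d k ρ)).hasDerivAt.comp ρ (hk.hasDerivAt_profile d ρ))
  have h2 : nonlinearity d k ε ∘ profile d k = k := funext (hk.nonlinearity_profile d hb)
  rw [h2] at h1
  have h3 := h1.unique (hk.hasDerivAt ρ)
  have := hk.radialMean_pos (d + 1) hb ρ
  rw [← h3]
  field_simp

/-- The equation `4 ρ P'' + 2 N P' = -k` for the profile. -/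
theorem profile_equation (ρ : ℝ) :
    4 * ρ * -(radialMean (d + 1 + 2) (deriv k) ρ / 2)
      + 2 * ((d : ℝ) + 2) * -(radialMean (d + 1) k ρ / 2) = -k ρ := by
  have h := radialMean_euler (hk.smooth.of_le (by simp)) (d + 1) ρ
  push_cast at h
  linarith

theorem hasDerivAt_profile_deriv (ρ : ℝ) :
    HasDerivAt (fun s => -(radialMean (d + 1) k s / 2))
      (-(radialMean (d + 1 + 2) (deriv k) ρ / 2)) ρ :=
  ((hasDerivAt_radialMean (d + 1) (hk.smooth.of_le (by simp)) ρ).div_const 2).neg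

end IsStep

/-! ### The cubic cutoff -/

/-- The derivative of the cubic step from `0` to `1`. -/
def bump (t : ℝ) : ℝ := max 0 (6 * t * (1 - t))

/-- The cubic step from `0` to `1`. -/
def cubicStep (v : ℝ) : ℝ := ∫ t in (0 : ℝ)..v, bump t

/-- The energy of the cubic step. -/
def stepEnergy (v : ℝ) : ℝ := ∫ t in (0 : ℝ)..v, bump t ^ 2

@[fun_prop]
theorem continuous_bump : Continuous bump := by unfold bump; fun_prop

theorem bump_of_nonpos {t : ℝ} (ht : t ≤ 0) : bump t = 0 :=
  max_eq_left (by nlinarith)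

theorem bump_of_one_le {t : ℝ} (ht : 1 ≤ t) : bump t = 0 :=
  max_eq_left (by nlinarith)

theorem bump_of_mem {t : ℝ} (h0 : 0 ≤ t) (h1 : t ≤ 1) : bump t = 6 * t * (1 - t) :=
  max_eq_right (mul_nonneg (by positivity) (by linarith))

theorem hasDerivAt_cubicStep (v : ℝ) : HasDerivAt cubicStep (bump v) v :=
  intervalIntegral.integral_hasDerivAt_right (continuous_bump.intervalIntegrable _ _)
    continuous_bump.stronglyMeasurable.stronglyMeasurableAtFilter continuous_bump.continuousAt

theorem hasDerivAt_stepEnergy (v : ℝ) : HasDerivAt stepEnergy (bump v ^ 2) v :=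
  intervalIntegral.integral_hasDerivAt_right
    ((by fun_prop : Continuous fun t => bump t ^ 2).intervalIntegrable _ _)
    (by fun_prop : Continuous fun t => bump t ^ 2).stronglyMeasurable.stronglyMeasurableAtFilter
    (by fun_prop : Continuous fun t => bump t ^ 2).continuousAt

theorem contDiff_cubicStep : ContDiff ℝ 1 cubicStep := by
  rw [contDiff_one_iff_deriv, funext fun v => (hasDerivAt_cubicStep v).deriv]
  exact ⟨fun v => (hasDerivAt_cubicStep v).differentiableAt, continuous_bump⟩

/-- The exponents n + 1 = 1 and 2 serve `cubicStep` and `stepEnergy` respectively. -/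
theorem integral_bump_of_nonpos (n : ℕ) {v : ℝ} (hv : v ≤ 0) :
    ∫ t in (0 : ℝ)..v, bump t ^ (n + 1) = 0 := by
  rw [intervalIntegral.integral_congr (g := fun _ => 0), intervalIntegral.integral_zero]
  intro t ht
  rw [uIcc_of_ge hv] at ht
  simp [bump_of_nonpos ht.2]

theorem integral_bump_of_one_le (n : ℕ) {v : ℝ} (hv : 1 ≤ v) :
    ∫ t in (0 : ℝ)..v, bump t ^ (n + 1) = ∫ t in (0 : ℝ)..1, (6 * t * (1 - t)) ^ (n + 1) := by
  have hc : Continuous fun t => bump t ^ (n + 1) := by fun_prop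
  rw [← intervalIntegral.integral_add_adjacent_intervals (hc.intervalIntegrable 0 1)
    (hc.intervalIntegrable 1 v), intervalIntegral.integral_congr (a := 1) (g := fun _ => 0),
    intervalIntegral.integral_zero, add_zero]
  · refine intervalIntegral.integral_congr fun t ht => ?_
    rw [uIcc_of_le zero_le_one] at ht
    simp only [bump_of_mem ht.1 ht.2]
  · intro t ht
    rw [uIcc_of_le hv] at ht
    simp [bump_of_one_le ht.1]

theorem cubicStep_of_nonpos {v : ℝ} (hv : v ≤ 0) : cubicStep v = 0 := by
  simpa [cubicStep] using integral_bump_of_nonpos 0 hv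

theorem stepEnergy_of_nonpos {v : ℝ} (hv : v ≤ 0) : stepEnergy v = 0 :=
  integral_bump_of_nonpos 1 hv

theorem cubicStep_of_one_le {v : ℝ} (hv : 1 ≤ v) : cubicStep v = 1 := by
  have h := integral_bump_of_one_le 0 hv
  simp only [zero_add, pow_one] at h
  rw [cubicStep, h, intervalIntegral.integral_eq_sub_of_hasDerivAt
    (f := fun t => 3 * t ^ 2 - 2 * t ^ 3) (fun t _ => ?_)
    ((by fun_prop : Continuous _).intervalIntegrable _ _)]
  · norm_num
  · refine (((hasDerivAt_pow 2 t).const_mul 3).sub ((hasDerivAt_pow 3 t).const_mul 2)).congr_deriv ?_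
    norm_num; ring

theorem stepEnergy_of_one_le {v : ℝ} (hv : 1 ≤ v) : stepEnergy v = 6 / 5 := by
  rw [stepEnergy, integral_bump_of_one_le 1 hv, intervalIntegral.integral_eq_sub_of_hasDerivAt
    (f := fun t => 12 * t ^ 3 - 18 * t ^ 4 + 36 / 5 * t ^ 5) (fun t _ => ?_)
    ((by fun_prop : Continuous _).intervalIntegrable _ _)]
  · norm_num
  · refine ((((hasDerivAt_pow 3 t).const_mul 12).sub ((hasDerivAt_pow 4 t).const_mul 18)).add
      ((hasDerivAt_pow 5 t).const_mul (36 / 5))).congr_deriv ?_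
    norm_num; ring

/-! ### The linearized potential and the Riccati inequality -/

/-- The radial derivative of the solution. -/
theorem IsStep.hasDerivAt_profile_sq {k : ℝ → ℝ} {b ε : ℝ} (hk : IsStep k b ε) (d : ℕ) (r : ℝ) :
    HasDerivAt (fun r => profile d k (r ^ 2)) (-(r * radialMean (d + 1) k (r ^ 2))) r := by
  refine ((hk.hasDerivAt_profile d (r ^ 2)).comp r (hasDerivAt_pow 2 r)).congr_deriv ?_
  norm_num; ring

theorem mul_radialMean_eq (d : ℕ) (k : ℝ → ℝ) {r : ℝ} (hr : 0 < r) :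
    r * radialMean (d + 1) k (r ^ 2) = flux (d + 1) k r / r ^ (d + 1) := by
  rw [← pow_mul_radialMean, pow_succ' r (d + 1), mul_assoc, mul_left_comm,
    mul_div_cancel_left₀ _ (by positivity)]

/-- The potential `f'(u)` of the linearized equation as a function of `r = |x|`. -/
def potential (d : ℕ) (k : ℝ → ℝ) (r : ℝ) : ℝ :=
  -2 * deriv k (r ^ 2) / radialMean (d + 1) k (r ^ 2)

/-- Exhibits the weighted potential as the exact derivative -(k(r²))' times a quotient that can be
bounded above and below on the shell; both index estimates rest on this. -/
theorem pow_mul_potential (d : ℕ) (k : ℝ → ℝ) {r : ℝ} (hr : 0 < r) :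
    r ^ (d + 1) * potential d k r =
      -(2 * r * deriv k (r ^ 2)) * (r ^ (2 * d + 2) / flux (d + 1) k r) := by
  rw [← pow_mul_radialMean, potential]
  by_cases h : radialMean (d + 1) k (r ^ 2) = 0
  · simp [h]
  · field_simp
    ring

namespace IsStep

variable {k : ℝ → ℝ} {b ε : ℝ} (hk : IsStep k b ε) (d : ℕ)
include hk

theorem deriv_of_le {ρ : ℝ} (hρ : ρ ≤ b ^ 2) : deriv k ρ = 0 :=
  IsLocalMax.deriv_eq_zero (Eventually.of_forall fun x => by
    rw [hk.eq_one ρ hρ]; exact hk.le_one x)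

theorem deriv_of_ge {ρ : ℝ} (hρ : ε ^ 2 ≤ ρ) : deriv k ρ = 0 :=
  IsLocalMin.deriv_eq_zero (Eventually.of_forall fun x => by
    rw [hk.eq_zero ρ hρ]; exact hk.nonneg x)

theorem hasDerivAt_sq (r : ℝ) : HasDerivAt (fun r => k (r ^ 2)) (2 * r * deriv k (r ^ 2)) r := by
  refine ((hk.hasDerivAt (r ^ 2)).comp r (hasDerivAt_pow 2 r)).congr_deriv ?_
  norm_num; ring

theorem continuous_potential (hb : 0 < b) : Continuous (potential d k) := by
  have h1 : Continuous (deriv k) := hk.smooth.continuous_deriv (by simp)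
  have h2 : Continuous (radialMean (d + 1) k) := (contDiff_radialMean hk.smooth _).continuous
  unfold potential
  exact Continuous.div (by fun_prop) (by fun_prop) fun r => (hk.radialMean_pos _ hb _).ne'

theorem potential_of_le {r : ℝ} (hr : 0 ≤ r) (hrb : r ≤ b) : potential d k r = 0 := by
  rw [potential, hk.deriv_of_le (by gcongr)]; simp

theorem potential_of_ge (hε : 0 ≤ ε) {r : ℝ} (hr : ε ≤ r) : potential d k r = 0 := by
  rw [potential, hk.deriv_of_ge (by gcongr)]; simp

/-- A Riccati inequality: functions vanishing at `ε` do not see the potential. -/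
theorem riccati (hb : 0 < b) (hbε : b ≤ ε)
    (hsmall : 4 * (d + 2) * ε ^ (2 * d + 2) * (ε - b) ≤ b ^ (2 * d + 3))
    {F F' : ℝ → ℝ} (hF : ∀ r, HasDerivAt F (F' r) r) (hF' : Continuous F') (hFε : F ε = 0) :
    0 ≤ ∫ r in b..ε, r ^ (d + 1) * (F' r ^ 2 - potential d k r * F r ^ 2) := by
  have hε : 0 < ε := hb.trans_le hbε
  have hFc : Continuous F := continuous_iff_continuousAt.2 fun r => (hF r).continuousAt
  have hVc := hk.continuous_potential d hb
  have hkc := hk.smooth.continuous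
  have hk'c : Continuous (deriv k) := hk.smooth.continuous_deriv (by simp)
  -- `B` bounds r^(2d+2) / flux from above on the shell, since r ≤ ε and the flux is at least
  -- b^(d+2)/(d+2).
  set B : ℝ := (d + 2) * ε ^ (2 * d + 2) / b ^ (d + 2) with hB
  have hB0 : 0 < B := by positivity
  -- Chosen so that (2B)² = A b^(d+1), where 2B will bound |ζ|; that bound needs A(ε - b) ≤ B, which
  -- is the thinness hypothesis `hsmall`.
  set A : ℝ := 4 * B ^ 2 / b ^ (d + 1) with hA
  have hA0 : 0 < A := by positivity
  have hAB : A * (ε - b) ≤ B := by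
    have : 4 * B * (ε - b) ≤ b ^ (d + 1) := by
      rw [hB]
      calc 4 * ((d + 2) * ε ^ (2 * d + 2) / b ^ (d + 2)) * (ε - b)
          = 4 * (d + 2) * ε ^ (2 * d + 2) * (ε - b) / b ^ (d + 2) := by ring
        _ ≤ b ^ (2 * d + 3) / b ^ (d + 2) := by gcongr
        _ = b ^ (d + 1) := by rw [show 2 * d + 3 = (d + 1) + (d + 2) by ring, pow_add]; field_simp
    rw [hA, div_mul_eq_mul_div, div_le_iff₀ (by positivity)]
    nlinarith
  -- The multiplier: its k-part absorbs the potential and its slope -A pays for the cross term. As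
  -- ζ(b) = 0 and F(ε) = 0, the integral of (ζF²)' vanishes, so it suffices that (ζF²)' lies below
  -- the integrand.
  set ζ : ℝ → ℝ := fun r => B * (k (r ^ 2) - 1) - A * (r - b) with hζ
  have hζd : ∀ r, HasDerivAt ζ (B * (2 * r * deriv k (r ^ 2)) - A) r := fun r => by
    refine ((((hk.hasDerivAt_sq r).sub_const 1).const_mul B).sub
      (((hasDerivAt_id r).sub_const b).const_mul A)).congr_deriv ?_
    ring
  have hζc : Continuous ζ := continuous_iff_continuousAt.2 fun r => (hζd r).continuousAt
  have hint : ∫ r in b..ε, ((B * (2 * r * deriv k (r ^ 2)) - A) * F r ^ 2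
      + ζ r * (2 * F r * F' r)) = ζ ε * F ε ^ 2 - ζ b * F b ^ 2 := by
    refine intervalIntegral.integral_eq_sub_of_hasDerivAt (f := fun r => ζ r * F r ^ 2)
      (fun r _ => ?_) ((by fun_prop : Continuous _).intervalIntegrable _ _)
    refine ((hζd r).mul ((hF r).pow 2)).congr_deriv ?_
    simp
  have hζb : ζ b = 0 := by simp [hζ, hk.eq_one _ le_rfl]
  rw [hFε, hζb] at hint
  simp only [ne_eq, OfNat.ofNat_ne_zero, not_false_eq_true, zero_pow, mul_zero, zero_mul,
    sub_zero] at hint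
  rw [← hint]
  refine intervalIntegral.integral_mono_on hbε ((by fun_prop : Continuous _).intervalIntegrable _ _)
    ((by fun_prop : Continuous _).intervalIntegrable _ _) fun r hr => ?_
  have hr0 : 0 < r := hb.trans_le hr.1
  have hk' := hk.deriv_nonpos (r ^ 2)
  have hfl := hk.le_flux (d + 1) hb.le hr.1
  push_cast at hfl
  have hq : r ^ (2 * d + 2) / flux (d + 1) k r ≤ B := by
    have h0 : 0 < b ^ (d + 1 + 1) / ((d : ℝ) + 1 + 1) := by positivity
    calc r ^ (2 * d + 2) / flux (d + 1) k r
        ≤ ε ^ (2 * d + 2) / (b ^ (d + 1 + 1) / ((d : ℝ) + 1 + 1)) := by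
          gcongr; exact hr.2
      _ = B := by rw [hB]; field_simp; ring
  have hW : r ^ (d + 1) * potential d k r ≤ -(2 * r * deriv k (r ^ 2)) * B := by
    rw [pow_mul_potential d k hr0]
    exact mul_le_mul_of_nonneg_left hq (by nlinarith)
  have hζ1 : |ζ r| ≤ 2 * B := by
    have h1 := hk.nonneg (r ^ 2)
    have h2 := hk.le_one (r ^ 2)
    have h3 : 0 ≤ A * (r - b) := mul_nonneg hA0.le (by linarith [hr.1])
    have h4 : A * (r - b) ≤ A * (ε - b) := by
      have := hr.2
      gcongr
    rw [abs_le, hζ]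
    constructor <;> simp only <;> nlinarith
  have hζ2 : ζ r ^ 2 ≤ A * r ^ (d + 1) := by
    calc ζ r ^ 2 = |ζ r| ^ 2 := (sq_abs _).symm
      _ ≤ (2 * B) ^ 2 := by gcongr
      _ = A * b ^ (d + 1) := by rw [hA]; field_simp; ring
      _ ≤ A * r ^ (d + 1) := by have := hr.1; gcongr
  -- Expand (AF - ζF')² ≥ 0, use ζ² ≤ A r^(d+1), and divide by A.
  have hsq : 2 * ζ r * (F r * F' r) ≤ r ^ (d + 1) * F' r ^ 2 + A * F r ^ 2 := by
    have h1 : A * (2 * ζ r * (F r * F' r)) ≤ A * (r ^ (d + 1) * F' r ^ 2 + A * F r ^ 2) := by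
      nlinarith [sq_nonneg (A * F r - ζ r * F' r), mul_le_mul_of_nonneg_right hζ2 (sq_nonneg (F' r))]
    exact le_of_mul_le_mul_left h1 hA0
  have hWF := mul_le_mul_of_nonneg_right hW (sq_nonneg (F r))
  nlinarith

end IsStep

/-! ### Size of the profile and a direction of negative energy -/

namespace IsStep

variable {k : ℝ → ℝ} {b ε : ℝ} (hk : IsStep k b ε) (d : ℕ)
include hk

/-- Outside the source u is radially harmonic, hence a constant plus flux/d · r^(-d), and it
vanishes at r = 1. -/
theorem profile_sq_eps (hd : 0 < d) (hε : 0 < ε) (hε1 : ε ≤ 1) :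
    profile d k (ε ^ 2) = flux (d + 1) k ε / d * ((ε ^ d)⁻¹ - 1) := by
  have hU := hk.hasDerivAt_profile_sq d
  have hd' : (0 : ℝ) < d := by exact_mod_cast hd
  have hder : ∀ r ∈ uIcc ε 1, HasDerivAt
      (fun r => profile d k (r ^ 2) - flux (d + 1) k ε / d * (r ^ d)⁻¹) 0 r := by
    intro r hr
    rw [uIcc_of_le hε1] at hr
    have hr0 : 0 < r := hε.trans_le hr.1
    refine ((hU r).sub (((hasDerivAt_pow d r).inv (by positivity)).const_mul _)).congr_deriv ?_
    rw [mul_radialMean_eq d k hr0, hk.flux_of_ge (d + 1) hε.le hr.1]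
    obtain ⟨m, rfl⟩ : ∃ m, d = m + 1 := ⟨d - 1, by omega⟩
    simp only [Nat.add_sub_cancel]
    field_simp
    ring
  have h := intervalIntegral.integral_eq_sub_of_hasDerivAt hder intervalIntegrable_const
  simp only [intervalIntegral.integral_zero, one_pow, profile_one, inv_one] at h
  linarith

/-- The difference between the barrier and u is nonincreasing in r and nonnegative at r = 1, so it
is nonnegative on [0, 1]. -/
theorem profile_le (hd : 0 < d) (hε : 0 < ε) {r : ℝ} (hr : 0 ≤ r) (hr1 : r ≤ 1) :
    profile d k (r ^ 2) ≤ 2 ^ (d + 1) * ε ^ 2 * ((1 + r / ε) ^ d)⁻¹ := by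
  have hU := hk.hasDerivAt_profile_sq d
  have hd' : (1 : ℝ) ≤ d := by exact_mod_cast hd
  set D : ℝ → ℝ := fun r => 2 ^ (d + 1) * ε ^ 2 * ((1 + r / ε) ^ d)⁻¹ - profile d k (r ^ 2) with hD
  have hder : ∀ r, 0 ≤ r → HasDerivAt D (r * radialMean (d + 1) k (r ^ 2)
      - 2 ^ (d + 1) * ε * d * ((1 + r / ε) ^ (d + 1))⁻¹) r := by
    intro r hr
    have h1 : HasDerivAt (fun r : ℝ => 1 + r / ε) (1 / ε) r :=
      ((hasDerivAt_id r).div_const ε).const_add 1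
    have h2 : 0 < 1 + r / ε := by positivity
    refine ((((h1.fun_pow d).inv (by positivity)).const_mul _).sub (hU r)).congr_deriv ?_
    obtain ⟨m, rfl⟩ : ∃ m, d = m + 1 := ⟨d - 1, by omega⟩
    simp only [Nat.add_sub_cancel]
    field_simp
    ring
  have hanti : AntitoneOn D (Ici 0) := by
    refine antitoneOn_of_hasDerivWithinAt_nonpos (convex_Ici (0 : ℝ))
      (fun x hx => (hder x hx).continuousAt.continuousWithinAt)
      (fun x hx => (hder x (interior_subset hx)).hasDerivWithinAt) (fun x hx => ?_)
    rw [interior_Ici, mem_Ioi] at hx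
    rw [sub_nonpos, mul_radialMean_eq d k hx, div_le_iff₀ (by positivity)]
    have hq : 0 < 1 + x / ε := by positivity
    -- For x ≤ ε the flux is at most x^(d+2) and 1 + x/ε ≤ 2; for x ≥ ε the flux is at most ε^(d+2)
    -- and 1 + x/ε ≤ 2x/ε.
    have hkey : flux (d + 1) k x * (1 + x / ε) ^ (d + 1) ≤ 2 ^ (d + 1) * ε * x ^ (d + 1) := by
      rcases le_total x ε with h | h
      · have h1 := hk.flux_le (d + 1) hx.le
        have h2 : flux (d + 1) k x ≤ ε * x ^ (d + 1) := by
          refine h1.trans ((div_le_self (by positivity) (by push_cast; linarith)).trans ?_)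
          rw [pow_succ' x (d + 1)]
          gcongr
        have h3 : 1 + x / ε ≤ 2 := by
          have : x / ε ≤ 1 := (div_le_one hε).2 h
          linarith
        calc _ ≤ ε * x ^ (d + 1) * 2 ^ (d + 1) := by gcongr
          _ = _ := by ring
      · have h1 := hk.flux_le_top (d + 1) hε.le hx.le
        have h2 : flux (d + 1) k x ≤ ε * ε ^ (d + 1) := by
          refine h1.trans ((div_le_self (by positivity) (by push_cast; linarith)).trans ?_)
          rw [pow_succ' ε (d + 1)]
        have h3 : 1 + x / ε ≤ 2 * (x / ε) := by
          have : 1 ≤ x / ε := (one_le_div hε).2 h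
          linarith
        calc _ ≤ ε * ε ^ (d + 1) * (2 * (x / ε)) ^ (d + 1) := by gcongr
          _ = _ := by rw [mul_pow, div_pow]; field_simp
    have : 2 ^ (d + 1) * ε * d * ((1 + x / ε) ^ (d + 1))⁻¹ * x ^ (d + 1)
        = d * (2 ^ (d + 1) * ε * x ^ (d + 1)) / (1 + x / ε) ^ (d + 1) := by field_simp
    rw [this, le_div_iff₀ (by positivity)]
    refine hkey.trans (le_mul_of_one_le_left (by positivity) hd')
  have h := hanti hr (mem_Ici.2 zero_le_one) hr1
  simp only [hD, one_pow, profile_one, sub_zero] at h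
  have : 0 ≤ 2 ^ (d + 1) * ε ^ 2 * ((1 + 1 / ε) ^ d)⁻¹ := by positivity
  linarith

/-- The second variation at a cubic step of the solution is negative. -/
theorem radial_energy_neg (hd : 0 < d) (hd7 : d ≤ 7) (hε : 0 < ε) (hε1 : ε ≤ 1 / 50)
    (hb : b = 999 / 1000 * ε) {α : ℝ} (hα : α = profile d k (ε ^ 2) / 50) :
    ∫ r in (0 : ℝ)..1, r ^ (d + 1) *
      ((bump ((profile d k (r ^ 2) - α) / (profile d k (ε ^ 2) - α))
          * (-(r * radialMean (d + 1) k (r ^ 2)) / (profile d k (ε ^ 2) - α))) ^ 2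
        - potential d k r
          * cubicStep ((profile d k (r ^ 2) - α) / (profile d k (ε ^ 2) - α)) ^ 2) < 0 := by
  have hb0 : 0 < b := by rw [hb]; positivity
  have hbε : b ≤ ε := by rw [hb]; linarith
  have hd' : (1 : ℝ) ≤ d := by exact_mod_cast hd
  have hd7' : (d : ℝ) ≤ 7 := by exact_mod_cast hd7
  have hU := hk.hasDerivAt_profile_sq d
  have hP := hk.profile_strictAnti d hb0
  have hVc := hk.continuous_potential d hb0
  have hPc : Continuous (profile d k) := (hk.contDiff_profile d).continuous
  have hTc : Continuous cubicStep := contDiff_cubicStep.continuous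
  have hk'c : Continuous (deriv k) := hk.smooth.continuous_deriv (by simp)
  have hMc : Continuous (radialMean (d + 1) k) := (contDiff_radialMean hk.smooth _).continuous
  have hβ := hk.profile_sq_eps d hd hε (by linarith)
  set β : ℝ := profile d k (ε ^ 2) with hβdef
  have hm : 0 < flux (d + 1) k ε := lt_of_lt_of_le (by positivity) (hk.le_flux (d + 1) hb0.le hbε)
  have hεd : ε ^ d ≤ 1 / 50 := (pow_le_of_le_one hε.le (by linarith) (by omega)).trans hε1
  have hβ0 : 0 < β := by
    rw [hβ]
    refine mul_pos (by positivity) (sub_pos.2 ((one_lt_inv₀ (by positivity)).2 (by linarith)))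
  have hβα : β - α = 49 / 50 * β := by rw [hα]; ring
  have hβα0 : 0 < β - α := by rw [hβα]; positivity
  set v : ℝ → ℝ := fun r => (profile d k (r ^ 2) - α) / (β - α) with hv
  set v' : ℝ → ℝ := fun r => -(r * radialMean (d + 1) k (r ^ 2)) / (β - α) with hv'
  have hvd : ∀ r, HasDerivAt v (v' r) r := fun r => ((hU r).sub_const α).div_const _
  have hvc : Continuous v := by simp only [hv]; fun_prop
  have hv'c : Continuous v' := by simp only [hv']; fun_prop
  have hv1 : ∀ r, 0 ≤ r → r ≤ ε → 1 ≤ v r := fun r h0 h1 => by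
    rw [hv, one_le_div hβα0, sub_le_sub_iff_right]
    exact hP.antitone (by gcongr)
  -- `c` bounds r^(2d+2) / flux from below on the shell; `l` is the constant value of -r^(d+1) v'
  -- for r ≥ ε. The integrand is thereby dominated by an exact derivative.
  set c : ℝ := b ^ (2 * d + 2) * (d + 2) / ε ^ (d + 2) with hc
  have hc0 : 0 < c := by positivity
  set l : ℝ := flux (d + 1) k ε / (β - α) with hl
  have hint : ∫ r in (0 : ℝ)..1, (c * (2 * r * deriv k (r ^ 2)) - l * (bump (v r) ^ 2 * v' r))
      = (c * k (1 ^ 2) - l * stepEnergy (v 1)) - (c * k (0 ^ 2) - l * stepEnergy (v 0)) := by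
    refine intervalIntegral.integral_eq_sub_of_hasDerivAt
      (f := fun r => c * k (r ^ 2) - l * stepEnergy (v r)) (fun r _ => ?_)
      ((by fun_prop : Continuous _).intervalIntegrable _ _)
    exact ((hk.hasDerivAt_sq r).const_mul c).sub
      (((hasDerivAt_stepEnergy (v r)).comp r (hvd r)).const_mul l)
  have hvone : v 1 ≤ 0 := by
    simp only [hv, one_pow, profile_one]
    refine div_nonpos_of_nonpos_of_nonneg ?_ hβα0.le
    rw [hα]; linarith
  rw [hk.eq_zero (1 ^ 2) (by gcongr; linarith), hk.eq_one (0 ^ 2) (by gcongr),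
    stepEnergy_of_nonpos hvone, stepEnergy_of_one_le (hv1 0 le_rfl hε.le)] at hint
  -- Cost against gain. With ε^d ≤ 1/50, α = β/50 and 0.999^16 ≥ 0.98 it reduces to (3000/2401) d <
  -- 0.98 (d + 2), which holds up to d = 7 and fails at d = 8.
  have hneg : l * (6 / 5) < c := by
    have hl' : l = d * ε ^ d / (49 / 50 * (1 - ε ^ d)) := by
      have : 0 < 1 - ε ^ d := by linarith
      rw [hl, hβα, hβ]
      field_simp
    have hc' : c = (999 / 1000) ^ (2 * d + 2) * (d + 2) * ε ^ d := by
      rw [hc, hb, mul_pow, show 2 * d + 2 = (d + 2) + d by ring, pow_add ε]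
      field_simp
    have hone : 49 / 50 * (49 / 50) ≤ 49 / 50 * (1 - ε ^ d) := by linarith
    have hpow : (999 / 1000 : ℝ) ^ 16 ≤ (999 / 1000) ^ (2 * d + 2) :=
      pow_le_pow_of_le_one (by norm_num) (by norm_num) (by omega)
    have hpow' : (98 / 100 : ℝ) ≤ (999 / 1000) ^ 16 := by norm_num
    have hpw : (98 / 100 : ℝ) * (d + 2) * ε ^ d ≤ c := by
      rw [hc']
      have := hpow'.trans hpow
      gcongr
    have hl2 : l ≤ d * ε ^ d / (49 / 50 * (49 / 50)) := by rw [hl']; gcongr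
    refine lt_of_lt_of_le ?_ hpw
    have h0 : 0 < ε ^ d := by positivity
    calc l * (6 / 5) ≤ d * ε ^ d / (49 / 50 * (49 / 50)) * (6 / 5) := by gcongr
      _ = (d / (49 / 50 * (49 / 50)) * (6 / 5)) * ε ^ d := by ring
      _ < (98 / 100 : ℝ) * (d + 2) * ε ^ d := by
        have : (d : ℝ) / (49 / 50 * (49 / 50)) * (6 / 5) = 3000 / 2401 * d := by ring
        rw [this]
        exact mul_lt_mul_of_pos_right (by linarith) h0
  refine lt_of_le_of_lt (b := c * 0 - l * 0 - (c * 1 - l * (6 / 5))) ?_ (by linarith)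
  rw [← hint]
  refine intervalIntegral.integral_mono_on zero_le_one
    ((by fun_prop : Continuous _).intervalIntegrable _ _)
    ((by fun_prop : Continuous _).intervalIntegrable _ _) fun r hr => ?_
  rcases hr.1.eq_or_lt with rfl | hr0
  · simp [hv']
  -- For r ≤ ε the cutoff is identically 1 and only the potential remains; for r ≥ ε the potential
  -- vanishes and the gradient term is exact.
  rcases le_total r ε with h | h
  · have h1 := hv1 r hr.1 h
    change r ^ (d + 1) * ((bump (v r) * v' r) ^ 2 - potential d k r * cubicStep (v r) ^ 2) ≤ _
    rw [bump_of_one_le h1, cubicStep_of_one_le h1]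
    have h2 := pow_mul_potential d k hr0
    have h3 : c * (2 * r * deriv k (r ^ 2))
        ≥ (2 * r * deriv k (r ^ 2)) * (r ^ (2 * d + 2) / flux (d + 1) k r) := by
      rcases le_total r b with hrb | hrb
      · rw [hk.deriv_of_le (by gcongr)]; simp
      · rw [mul_comm c]
        refine mul_le_mul_of_nonpos_left ?_
          (mul_nonpos_of_nonneg_of_nonpos (by positivity) (hk.deriv_nonpos _))
        have h4 := hk.flux_le_top (d + 1) hε.le hr.1
        have h5 := hk.le_flux (d + 1) hb0.le hrb
        have h6 : 0 < flux (d + 1) k r := lt_of_lt_of_le (by positivity) h5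
        push_cast at h4
        calc c = b ^ (2 * d + 2) / (ε ^ (d + 1 + 1) / ((d : ℝ) + 1 + 1)) := by
              rw [hc]; field_simp; ring
          _ ≤ _ := by gcongr
    linarith
  · change r ^ (d + 1) * ((bump (v r) * v' r) ^ 2 - potential d k r * cubicStep (v r) ^ 2) ≤ _
    rw [hk.potential_of_ge d hε.le h, hk.deriv_of_ge (by gcongr)]
    have h1 : r ^ (d + 1) * v' r = -l := by
      simp only [hv', hl]
      rw [mul_radialMean_eq d k hr0, hk.flux_of_ge (d + 1) hε.le h]
      field_simp
    refine le_of_eq ?_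
    linear_combination (bump (v r)) ^ 2 * v' r * h1

end IsStep

/-! ### Radial calculus in Euclidean space -/

section Calculus

variable {N : ℕ}

theorem hasFDerivAt_comp_norm_sq {P : ℝ → ℝ} {p : ℝ} {x : EuclideanSpace ℝ (Fin N)}
    (hP : HasDerivAt P p (‖x‖ ^ 2)) :
    HasFDerivAt (fun x => P (‖x‖ ^ 2)) ((2 * p) • innerSL ℝ x) x := by
  refine (hP.comp_hasFDerivAt x (hasStrictFDerivAt_norm_sq x).hasFDerivAt).congr_fderiv ?_
  ext y
  simp
  ring

theorem laplacian_comp_norm_sq {P P' P'' : ℝ → ℝ} (hP : ∀ ρ, HasDerivAt P (P' ρ) ρ)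
    (hP' : ∀ ρ, HasDerivAt P' (P'' ρ) ρ) (x : EuclideanSpace ℝ (Fin N)) :
    Laplacian.laplacian (fun x : EuclideanSpace ℝ (Fin N) => P (‖x‖ ^ 2)) x
      = 4 * ‖x‖ ^ 2 * P'' (‖x‖ ^ 2) + 2 * N * P' (‖x‖ ^ 2) := by
  have h1 : fderiv ℝ (fun x : EuclideanSpace ℝ (Fin N) => P (‖x‖ ^ 2))
      = fun x => (2 * P' (‖x‖ ^ 2)) • innerSL ℝ x :=
    funext fun x => (hasFDerivAt_comp_norm_sq (hP _)).fderiv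
  have h2 : HasFDerivAt (fun x : EuclideanSpace ℝ (Fin N) => (2 * P' (‖x‖ ^ 2)) • innerSL ℝ x)
      _ x := ((hasFDerivAt_comp_norm_sq (hP' (‖x‖ ^ 2))).const_mul 2).smul
        (innerSL ℝ (E := EuclideanSpace ℝ (Fin N))).hasFDerivAt
  rw [congrFun (InnerProductSpace.laplacian_eq_iteratedFDeriv_orthonormalBasis _
    (EuclideanSpace.basisFun (Fin N) ℝ)) x]
  simp only [iteratedFDeriv_two_apply, h1, h2.fderiv]
  have h3 : ∑ i, (x i) ^ 2 = ‖x‖ ^ 2 := by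
    rw [EuclideanSpace.norm_sq_eq]; simp
  generalize hc : P'' (‖x‖ ^ 2) = c
  have h4 : ∑ i, 2 * (2 * c * x i) * x i = 4 * ‖x‖ ^ 2 * c := by
    rw [← h3, Finset.mul_sum, Finset.sum_mul]
    exact Finset.sum_congr rfl fun i _ => by ring
  have h5 (i : Fin N) : (innerSL ℝ (E := EuclideanSpace ℝ (Fin N)))
      (EuclideanSpace.single i 1) (EuclideanSpace.single i 1) = 1 := by
    rw [innerSL_apply_apply]; simp
  simp [Finset.sum_add_distrib, EuclideanSpace.inner_single_right, h5]
  rw [h4]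
  ring

theorem norm_gradient_eq {φ : EuclideanSpace ℝ (Fin N) → ℝ} (x : EuclideanSpace ℝ (Fin N)) :
    ‖gradient φ x‖ = ‖fderiv ℝ φ x‖ := by
  rw [gradient, LinearIsometryEquiv.norm_map]

theorem norm_gradient_comp_norm_sq {P : ℝ → ℝ} {p : ℝ} {x : EuclideanSpace ℝ (Fin N)}
    (hP : HasDerivAt P p (‖x‖ ^ 2)) :
    ‖gradient (fun x => P (‖x‖ ^ 2)) x‖ ^ 2 = (2 * ‖x‖ * p) ^ 2 := by
  rw [norm_gradient_eq, (hasFDerivAt_comp_norm_sq hP).fderiv, norm_smul, innerSL_apply_norm,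
    mul_pow, Real.norm_eq_abs, sq_abs]
  ring

theorem hasDerivAt_ray {φ : EuclideanSpace ℝ (Fin N) → ℝ} (hφ : ContDiff ℝ 1 φ)
    (e : EuclideanSpace ℝ (Fin N)) (r : ℝ) :
    HasDerivAt (fun r : ℝ => φ (r • e)) (fderiv ℝ φ (r • e) e) r := by
  have h1 : HasDerivAt (fun r : ℝ => r • e) e r := by
    simpa using (hasDerivAt_id r).smul_const e
  exact ((hφ.differentiable one_ne_zero _).hasFDerivAt).comp_hasDerivAt r h1

theorem radial_apply {φ : EuclideanSpace ℝ (Fin N) → ℝ} (hr : IsRadialOn φ univ)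
    {e : EuclideanSpace ℝ (Fin N)} (he : ‖e‖ = 1) (x : EuclideanSpace ℝ (Fin N)) :
    φ (‖x‖ • e) = φ x :=
  hr _ (mem_univ _) _ (mem_univ _) (by simp [norm_smul, he])

/-- By radiality the derivative along `e` at ‖x‖e equals the one along x/‖x‖ at x, which the
operator norm bounds. This one inequality suffices for a lower bound on the second variation. -/
theorem ray_deriv_sq_le {φ : EuclideanSpace ℝ (Fin N) → ℝ} (hφ : ContDiff ℝ 1 φ)
    (hr : IsRadialOn φ univ) {e : EuclideanSpace ℝ (Fin N)} (he : ‖e‖ = 1)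
    {x : EuclideanSpace ℝ (Fin N)} (hx : x ≠ 0) :
    (fderiv ℝ φ (‖x‖ • e) e) ^ 2 ≤ ‖gradient φ x‖ ^ 2 := by
  have hx' : 0 < ‖x‖ := norm_pos_iff.2 hx
  set y := ‖x‖⁻¹ • x with hy
  have hy1 : ‖y‖ = 1 := by rw [hy, norm_smul, norm_inv, norm_norm, inv_mul_cancel₀ hx'.ne']
  have hxy : ‖x‖ • y = x := by rw [hy, smul_inv_smul₀ hx'.ne']
  have h1 := hasDerivAt_ray hφ e ‖x‖
  have h2 := hasDerivAt_ray hφ y ‖x‖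
  have h3 : (fun r : ℝ => φ (r • e)) = fun r : ℝ => φ (r • y) :=
    funext fun r => hr _ (mem_univ _) _ (mem_univ _) (by simp [norm_smul, he, hy1])
  rw [h3] at h1
  rw [h1.unique h2, hxy, norm_gradient_eq, ← sq_abs]
  gcongr
  simpa [hy1] using (fderiv ℝ φ x).le_opNorm y

end Calculus

/-! ### The radial Morse index on the ball -/

section Morse

variable {d : ℕ} {k : ℝ → ℝ} {b ε : ℝ}

/-- The solution `x ↦ P(|x|²)`. -/
def solution (d : ℕ) (k : ℝ → ℝ) (x : EuclideanSpace ℝ (Fin (d + 2))) : ℝ := profile d k (‖x‖ ^ 2)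

theorem IsStep.secondVariation_eq (hk : IsStep k b ε) (hb : 0 < b)
    (φ : EuclideanSpace ℝ (Fin (d + 2)) → ℝ) :
    secondVariation (ball 0 1) (nonlinearity d k ε) (solution d k) φ
      = ∫ x in ball 0 1, (‖gradient φ x‖ ^ 2 - potential d k ‖x‖ * φ x ^ 2) := by
  simp only [secondVariation, solution, hk.deriv_nonlinearity_profile d hb, potential]

theorem integral_radial (G : ℝ → ℝ) :
    ∫ x : EuclideanSpace ℝ (Fin (d + 2)), G ‖x‖
      = ((d + 2) * volume.real (ball (0 : EuclideanSpace ℝ (Fin (d + 2))) 1))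
        * ∫ r in Ioi (0 : ℝ), r ^ (d + 1) * G r := by
  rw [integral_fun_norm_addHaar volume G]
  simp [mul_assoc]

theorem volume_ball_pos : 0 < volume.real (ball (0 : EuclideanSpace ℝ (Fin (d + 2))) 1) :=
  ENNReal.toReal_pos (measure_ball_pos _ _ one_pos).ne' measure_ball_lt_top.ne

/-- In polar coordinates the shell contributes a nonnegative amount by `riccati`; off the shell the
potential is zero and only the gradient term is left. -/
theorem IsStep.secondVariation_nonneg (hk : IsStep k b ε) (hb : 0 < b) (hbε : b ≤ ε)
    (hsmall : 4 * (d + 2) * ε ^ (2 * d + 2) * (ε - b) ≤ b ^ (2 * d + 3))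
    {e : EuclideanSpace ℝ (Fin (d + 2))} (he : ‖e‖ = 1)
    {φ : EuclideanSpace ℝ (Fin (d + 2)) → ℝ} (hφ : φ ∈ radialTestSpace (ball 0 1))
    (hφ0 : φ (ε • e) = 0) :
    0 ≤ secondVariation (ball 0 1) (nonlinearity d k ε) (solution d k) φ := by
  obtain ⟨hC, hcs, hts, hrad⟩ := hφ
  have hε : 0 < ε := hb.trans_le hbε
  have hVc := hk.continuous_potential d hb
  have hfc : Continuous (fderiv ℝ φ) := hC.continuous_fderiv one_ne_zero
  have hφc := hC.continuous
  set F : ℝ → ℝ := fun r => φ (r • e) with hF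
  set F' : ℝ → ℝ := fun r => fderiv ℝ φ (r • e) e with hF'
  have hFd : ∀ r, HasDerivAt F (F' r) r := hasDerivAt_ray hC e
  have hFc : Continuous F := by simp only [hF]; fun_prop
  have hF'c : Continuous F' := by simp only [hF']; fun_prop
  set G : ℝ → ℝ := fun r => F' r ^ 2 - potential d k r * F r ^ 2 with hG
  have hGc : Continuous G := by simp only [hG]; fun_prop
  have hout : ∀ x : EuclideanSpace ℝ (Fin (d + 2)), x ∉ ball 0 1 → φ x = 0 ∧ fderiv ℝ φ x = 0 := by
    intro x hx
    have h1 : x ∉ tsupport φ := fun h => hx (hts h)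
    exact ⟨image_eq_zero_of_notMem_tsupport h1, by
      by_contra h2
      exact h1 (support_fderiv_subset ℝ h2)⟩
  have hg2 : Continuous fun x => ‖gradient φ x‖ ^ 2 - potential d k ‖x‖ * φ x ^ 2 := by
    simp only [norm_gradient_eq]
    fun_prop
  have hcpt := isCompact_closedBall (0 : EuclideanSpace ℝ (Fin (d + 2))) 1
  have hint1 : Integrable fun x => ‖gradient φ x‖ ^ 2 - potential d k ‖x‖ * φ x ^ 2 := by
    refine hg2.integrable_of_hasCompactSupport (HasCompactSupport.intro hcpt fun x hx => ?_)
    obtain ⟨h1, h2⟩ := hout x fun h => hx (ball_subset_closedBall h)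
    rw [norm_gradient_eq, h1, h2]; simp
  have hint2 : Integrable fun x : EuclideanSpace ℝ (Fin (d + 2)) => G ‖x‖ := by
    refine (hGc.comp continuous_norm).integrable_of_hasCompactSupport
      (HasCompactSupport.intro hcpt fun x hx => ?_)
    obtain ⟨h1, h2⟩ := hout (‖x‖ • e) fun h => hx (ball_subset_closedBall
      (by simpa [norm_smul, he] using h))
    simp [hG, hF, hF', h1, h2]
  have hle : ∫ x : EuclideanSpace ℝ (Fin (d + 2)), G ‖x‖
      ≤ ∫ x, (‖gradient φ x‖ ^ 2 - potential d k ‖x‖ * φ x ^ 2) := by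
    refine integral_mono_ae hint2 hint1 ?_
    filter_upwards [compl_mem_ae_iff.2 (measure_singleton (0 : EuclideanSpace ℝ (Fin (d + 2))))]
      with x hx
    simp only [hG, hF, hF', radial_apply hrad he]
    exact sub_le_sub_right (ray_deriv_sq_le hC hrad he hx) _
  rw [hk.secondVariation_eq hb, setIntegral_eq_integral_of_forall_compl_eq_zero]
  · refine le_trans ?_ hle
    rw [integral_radial]
    refine mul_nonneg (mul_nonneg (by positivity) volume_ball_pos.le) ?_
    have hint3 : IntegrableOn (fun r => r ^ (d + 1) * G r) (Ioi 0) := by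
      simpa using (integrable_fun_norm_addHaar volume).1 hint2
    calc 0 ≤ ∫ r in b..ε, r ^ (d + 1) * G r := hk.riccati d hb hbε hsmall hFd hF'c hφ0
      _ = ∫ r in Ioi (0 : ℝ), (Ioc b ε).indicator (fun r => r ^ (d + 1) * G r) r := by
        rw [intervalIntegral.integral_of_le hbε, setIntegral_indicator measurableSet_Ioc,
          inter_eq_right.2 (show Ioc b ε ⊆ Ioi 0 from fun r hr => hb.trans hr.1)]
      _ ≤ _ := by
        refine setIntegral_mono_on (hint3.indicator measurableSet_Ioc) hint3 measurableSet_Ioi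
          fun r hr => ?_
        have hr0 : 0 < r := hr
        by_cases hmem : r ∈ Ioc b ε
        · rw [indicator_of_mem hmem]
        · have hV : potential d k r = 0 := by
            rcases le_or_gt r b with h | h
            · exact hk.potential_of_le d hr0.le h
            · exact hk.potential_of_ge d hε.le (not_le.1 fun h' => hmem ⟨h, h'⟩).le
          rw [indicator_of_notMem hmem]
          simp only [hG, hV, zero_mul, sub_zero]
          positivity
  · intro x hx
    obtain ⟨h1, h2⟩ := hout x hx
    rw [norm_gradient_eq, h1, h2]; simp


/-- A cubic step of the solution. -/
def testFunction (d : ℕ) (k : ℝ → ℝ) (ε : ℝ) (x : EuclideanSpace ℝ (Fin (d + 2))) : ℝ :=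
  cubicStep ((solution d k x - profile d k (ε ^ 2) / 50)
    / (profile d k (ε ^ 2) - profile d k (ε ^ 2) / 50))

theorem IsStep.contDiff_solution (hk : IsStep k b ε) : ContDiff ℝ ∞ (solution d k) :=
  (hk.contDiff_profile d).comp (contDiff_norm_sq ℝ)

theorem IsStep.profile_eps_pos (hk : IsStep k b ε) (hb : 0 < b) (hε : 0 < ε) (hε1 : ε < 1) :
    0 < profile d k (ε ^ 2) := by
  rw [← profile_one d k]
  exact hk.profile_strictAnti d hb (by nlinarith)

/-- The threshold P(ε²)/50 is positive, so the support lies in a closed superlevel set of u that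
stays inside the open ball. -/
theorem IsStep.testFunction_mem (hk : IsStep k b ε) (hb : 0 < b) (hε : 0 < ε) (hε1 : ε < 1) :
    testFunction d k ε ∈ radialTestSpace (ball 0 1) := by
  have hβ := hk.profile_eps_pos (d := d) hb hε hε1
  set β := profile d k (ε ^ 2) with hβd
  have hsub : tsupport (testFunction d k ε) ⊆ {x | β / 50 ≤ solution d k x} := by
    refine closure_minimal (fun x hx => ?_)
      (isClosed_le continuous_const hk.contDiff_solution.continuous)
    by_contra h
    replace h : solution d k x < β / 50 := not_le.1 h
    exact hx (cubicStep_of_nonpos (div_nonpos_of_nonpos_of_nonneg (by linarith) (by linarith)))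
  have hball : tsupport (testFunction d k ε) ⊆ ball 0 1 := by
    intro x hx
    have h1 : 0 < profile d k (‖x‖ ^ 2) :=
      lt_of_lt_of_le (by positivity) (show β / 50 ≤ profile d k (‖x‖ ^ 2) from hsub hx)
    rw [← profile_one d k, (hk.profile_strictAnti d hb).lt_iff_gt] at h1
    rw [mem_ball_zero_iff]
    nlinarith [norm_nonneg x]
  refine ⟨?_, ?_, hball, ?_⟩
  · exact contDiff_cubicStep.comp
      (((hk.contDiff_solution.of_le (by simp)).sub contDiff_const).div_const _)
  · exact (isCompact_closedBall 0 1).of_isClosed_subset (isClosed_tsupport _)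
      (hball.trans ball_subset_closedBall)
  · intro x _ y _ hxy
    simp only [testFunction, solution, hxy]

theorem IsStep.secondVariation_testFunction_neg (hk : IsStep k b ε) (hd : 0 < d) (hd7 : d ≤ 7)
    (hε : 0 < ε) (hε1 : ε ≤ 1 / 50) (hb : b = 999 / 1000 * ε) :
    secondVariation (ball 0 1) (nonlinearity d k ε) (solution d k) (testFunction d k ε) < 0 := by
  have hb0 : 0 < b := by rw [hb]; positivity
  have hβ := hk.profile_eps_pos (d := d) hb0 hε (by linarith)
  have henergy := hk.radial_energy_neg d hd hd7 hε hε1 hb rfl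
  have hP := hk.profile_strictAnti d hb0
  set β := profile d k (ε ^ 2) with hβd
  set G : ℝ → ℝ := fun r =>
    (bump ((profile d k (r ^ 2) - β / 50) / (β - β / 50))
        * (-(r * radialMean (d + 1) k (r ^ 2)) / (β - β / 50))) ^ 2
      - potential d k r * cubicStep ((profile d k (r ^ 2) - β / 50) / (β - β / 50)) ^ 2 with hG
  have hout : ∀ r : ℝ, 1 ≤ r → G r = 0 := by
    intro r hr
    have h1 : profile d k (r ^ 2) ≤ 0 := by
      rw [← profile_one d k]
      exact hP.antitone (by nlinarith)
    have h2 : (profile d k (r ^ 2) - β / 50) / (β - β / 50) ≤ 0 :=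
      div_nonpos_of_nonpos_of_nonneg (by linarith) (by linarith)
    simp [hG, bump_of_nonpos h2, cubicStep_of_nonpos h2]
  have hpt : ∀ x : EuclideanSpace ℝ (Fin (d + 2)),
      ‖gradient (testFunction d k ε) x‖ ^ 2 - potential d k ‖x‖ * testFunction d k ε x ^ 2
        = G ‖x‖ := by
    intro x
    have h1 : HasDerivAt (fun ρ => cubicStep ((profile d k ρ - β / 50) / (β - β / 50)))
        (bump ((profile d k (‖x‖ ^ 2) - β / 50) / (β - β / 50))
          * (-(radialMean (d + 1) k (‖x‖ ^ 2) / 2) / (β - β / 50))) (‖x‖ ^ 2) :=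
      (hasDerivAt_cubicStep _).comp _
        (((hk.hasDerivAt_profile d (‖x‖ ^ 2)).sub_const _).div_const _)
    have h2 := norm_gradient_comp_norm_sq h1
    rw [show testFunction d k ε = fun x : EuclideanSpace ℝ (Fin (d + 2)) =>
      cubicStep ((profile d k (‖x‖ ^ 2) - β / 50) / (β - β / 50)) from rfl, h2]
    simp only [hG]
    ring
  rw [hk.secondVariation_eq hb0]
  simp only [hpt]
  rw [setIntegral_eq_integral_of_forall_compl_eq_zero, integral_radial]
  · refine mul_neg_of_pos_of_neg (mul_pos (by positivity) volume_ball_pos) ?_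
    rwa [intervalIntegral.integral_of_le zero_le_one,
      ← setIntegral_eq_of_subset_of_forall_sdiff_eq_zero measurableSet_Ioi
        (show Ioc (0 : ℝ) 1 ⊆ Ioi 0 from fun r hr => hr.1)] at henergy
    intro r hr
    have h1 : 1 ≤ r := (not_le.1 fun h => hr.2 ⟨hr.1, h⟩).le
    have := hout r h1
    simp only [hG] at this
    rw [this, mul_zero]
  · intro x hx
    exact hout _ (by simpa using hx)

theorem secondVariation_smul {N : ℕ} (Ω : Set (EuclideanSpace ℝ (Fin N))) (f : ℝ → ℝ)
    (u φ : EuclideanSpace ℝ (Fin N) → ℝ) (c : ℝ) :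
    secondVariation Ω f u (c • φ) = c ^ 2 * secondVariation Ω f u φ := by
  rw [secondVariation, secondVariation, ← integral_const_mul]
  congr 1
  ext x
  rw [norm_gradient_eq, norm_gradient_eq, fderiv_const_smul_field, Pi.smul_apply, Pi.smul_apply,
    norm_smul, mul_pow, Real.norm_eq_abs, sq_abs, smul_eq_mul]
  ring

/-- If some test function is a direction of negative second variation and the second variation is
nonnegative on the test functions vanishing at a point, then the radial Morse index is `1`. -/
theorem hasRadialMorseIndex_one {N : ℕ} {Ω : Set (EuclideanSpace ℝ (Fin N))} {f : ℝ → ℝ}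
    {u φ₀ : EuclideanSpace ℝ (Fin N) → ℝ} (x₀ : EuclideanSpace ℝ (Fin N))
    (hmem : φ₀ ∈ radialTestSpace Ω) (hneg : secondVariation Ω f u φ₀ < 0)
    (hnonneg : ∀ φ ∈ radialTestSpace Ω, φ x₀ = 0 → 0 ≤ secondVariation Ω f u φ) :
    HasRadialMorseIndex Ω f u 1 := by
  constructor
  · have h0 : φ₀ ≠ 0 := by
      rintro rfl
      have := secondVariation_smul Ω f u 0 0
      simp only [smul_zero] at this
      linarith
    refine ⟨Submodule.span ℝ {φ₀}, ?_, inferInstance, finrank_span_singleton h0, ?_⟩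
    · rwa [Submodule.span_singleton_le_iff_mem]
    · intro φ hφ hne
      obtain ⟨c, rfl⟩ := Submodule.mem_span_singleton.1 hφ
      rw [secondVariation_smul]
      have hc : c ≠ 0 := by rintro rfl; simp at hne
      exact mul_neg_of_pos_of_neg (by positivity) hneg
  · rintro m ⟨X, hX, hfin, rfl, hXneg⟩
    by_contra! h
    -- Evaluation at x₀ is a single linear functional, so it has a nonzero kernel on a space of
    -- dimension at least 2.
    have hker := LinearMap.ker_ne_bot_of_finrank_lt
      (f := (LinearMap.proj (R := ℝ) (φ := fun _ => ℝ) x₀).comp X.subtype) (by simpa using h)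
    obtain ⟨φ, hφ, hne⟩ := Submodule.exists_mem_ne_zero_of_ne_bot hker
    have h1 := hXneg φ φ.2 (by simpa using hne)
    have h2 := hnonneg φ (hX φ.2) hφ
    linarith

theorem IsStep.hasRadialMorseIndex (hk : IsStep k b ε) (hd : 0 < d) (hd7 : d ≤ 7)
    (hε : 0 < ε) (hε1 : ε ≤ 1 / 50) (hb : b = 999 / 1000 * ε) :
    HasRadialMorseIndex (ball 0 1) (nonlinearity d k ε) (solution d k) 1 := by
  have hb0 : 0 < b := by rw [hb]; positivity
  have he : ‖EuclideanSpace.single (0 : Fin (d + 2)) (1 : ℝ)‖ = 1 := by simp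
  refine hasRadialMorseIndex_one _ (hk.testFunction_mem hb0 hε (by linarith))
    (hk.secondVariation_testFunction_neg hd hd7 hε hε1 hb)
    fun φ hφ h0 => hk.secondVariation_nonneg hb0 (by rw [hb]; linarith) ?_ he hφ h0
  have hd7' : (d : ℝ) ≤ 7 := by exact_mod_cast hd7
  have hpow : (999 / 1000 : ℝ) ^ 17 ≤ (999 / 1000) ^ (2 * d + 3) :=
    pow_le_pow_of_le_one (by norm_num) (by norm_num) (by omega)
  -- 36/1000 is 4(d + 2)(1 - 999/1000) at d = 7, the largest case of the thinness condition.
  have hpow' : (36 / 1000 : ℝ) ≤ (999 / 1000) ^ 17 := by norm_num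
  calc 4 * (d + 2) * ε ^ (2 * d + 2) * (ε - b)
      = 4 * (d + 2) / 1000 * ε ^ (2 * d + 3) := by rw [hb]; ring
    _ ≤ (999 / 1000) ^ (2 * d + 3) * ε ^ (2 * d + 3) := by
      gcongr
      linarith
    _ = b ^ (2 * d + 3) := by rw [hb, mul_pow]

theorem IsStep.solvesDirichlet (hk : IsStep k b ε) (hb : 0 < b) :
    SolvesDirichlet (ball 0 1) (nonlinearity d k ε) (solution d k) := by
  constructor
  · intro x _
    have h := laplacian_comp_norm_sq (hk.hasDerivAt_profile d) (hk.hasDerivAt_profile_deriv d) x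
    have h2 := hk.profile_equation d (‖x‖ ^ 2)
    push_cast at h
    rw [solution, hk.nonlinearity_profile d hb]
    rw [show solution d k = fun x => profile d k (‖x‖ ^ 2) from rfl, h]
    linarith
  · intro x hx
    rw [frontier_ball _ one_ne_zero, mem_sphere_zero_iff_norm] at hx
    rw [solution, hx, one_pow, profile_one]

end Morse

/-! ### Growth of the norms -/

/-- Comparison with c times the indicator of s. For p = ∞ the convention 1 / 0 = 0 makes the
exponent zero, so the bound is c, as it should be. -/
theorem mul_rpow_le_normLp {N : ℕ} {p : ℝ≥0∞} (hp : p ≠ 0) {Ω s : Set (EuclideanSpace ℝ (Fin N))}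
    (hs : MeasurableSet s) (hsΩ : s ⊆ Ω) (hs0 : volume s ≠ 0)
    {u : EuclideanSpace ℝ (Fin N) → ℝ} (hu : MemLp u p (volume.restrict Ω)) {c : ℝ} (hc : 0 ≤ c)
    (hcu : ∀ x ∈ s, c ≤ u x) :
    c * volume.real s ^ (1 / p.toReal) ≤ normLp p Ω u := by
  have hμ : (volume.restrict Ω) s = volume s := by
    rw [Measure.restrict_apply hs, inter_eq_left.2 hsΩ]
  have h1 : eLpNorm (s.indicator fun _ => c) p (volume.restrict Ω) ≤
      eLpNorm u p (volume.restrict Ω) := by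
    refine eLpNorm_mono fun x => ?_
    by_cases hx : x ∈ s
    · rw [indicator_of_mem hx, Real.norm_of_nonneg hc]
      exact (hcu x hx).trans (Real.le_norm_self _)
    · rw [indicator_of_notMem hx, norm_zero]; exact norm_nonneg _
  rw [eLpNorm_indicator_const' hs (by rwa [hμ]) hp, hμ] at h1
  have h2 := ENNReal.toReal_mono hu.eLpNorm_ne_top h1
  rwa [ENNReal.toReal_mul, ← ENNReal.toReal_rpow, toReal_enorm, Real.norm_of_nonneg hc] at h2

/-- The function `(1 + |x|)⁻ᵈ`. -/
def decay (d : ℕ) (x : EuclideanSpace ℝ (Fin (d + 2))) : ℝ := ((1 + ‖x‖) ^ d)⁻¹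

theorem continuous_decay (d : ℕ) : Continuous (decay d) := by
  unfold decay
  exact Continuous.inv₀ (by fun_prop) fun x => by positivity

theorem eLpNorm_decay_lt_top (d : ℕ) {r : NNReal} (hr : ((d : ℝ) + 2) < d * r) :
    eLpNorm (decay d) r volume < ⊤ := by
  have hr0 : r ≠ 0 := by
    rintro rfl
    simp at hr
    linarith [(Nat.cast_nonneg d : (0 : ℝ) ≤ d)]
  rw [eLpNorm_lt_top_iff_lintegral_rpow_enorm_lt_top (by simpa using hr0) (by simp)]
  convert! finite_integral_one_add_norm (E := EuclideanSpace ℝ (Fin (d + 2))) (μ := volume)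
    (r := d * r) (by simpa using hr) using 3 with x
  have h1 : (0 : ℝ) < 1 + ‖x‖ := by positivity
  rw [Real.enorm_eq_ofReal (by unfold decay; positivity), ENNReal.coe_toReal,
    ENNReal.ofReal_rpow_of_pos (by unfold decay; positivity), decay, ← Real.rpow_natCast,
    ← Real.rpow_neg h1.le, ← Real.rpow_mul h1.le, neg_mul]

theorem eLpNorm_decay_scaled (d : ℕ) (r : NNReal) {ε : ℝ} (hε : 0 < ε) :
    eLpNorm (fun x => decay d (ε⁻¹ • x)) r volume
      = ENNReal.ofReal (ε ^ (d + 2)) ^ (1 / (r : ℝ)) * eLpNorm (decay d) r volume := by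
  have hε' : ε⁻¹ ≠ 0 := inv_ne_zero hε.ne'
  have h := eLpNorm_map_measure (p := r) (μ := volume)
    (f := fun x : EuclideanSpace ℝ (Fin (d + 2)) => ε⁻¹ • x)
    (continuous_decay d).aestronglyMeasurable (continuous_const_smul _).aemeasurable
  rw [Measure.map_addHaar_smul _ hε', eLpNorm_smul_measure_of_ne_top (by simp)] at h
  have h2 : |(ε⁻¹ ^ (d + 2))⁻¹| = ε ^ (d + 2) := by
    rw [inv_pow, inv_inv, abs_of_pos (by positivity)]
  rw [finrank_euclideanSpace_fin, h2] at h
  simpa [Function.comp_def] using h.symm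

variable {d : ℕ} {k : ℝ → ℝ} {b ε : ℝ}

theorem IsStep.solution_nonneg (hk : IsStep k b ε) (hb : 0 < b)
    {x : EuclideanSpace ℝ (Fin (d + 2))} (hx : x ∈ ball 0 1) : 0 ≤ solution d k x := by
  rw [mem_ball_zero_iff] at hx
  rw [← profile_one d k, solution]
  exact (hk.profile_strictAnti d hb).antitone (by nlinarith [norm_nonneg x])

theorem IsStep.solution_le (hk : IsStep k b ε) (hd : 0 < d) (hε : 0 < ε)
    {x : EuclideanSpace ℝ (Fin (d + 2))} (hx : x ∈ ball 0 1) :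
    solution d k x ≤ 2 ^ (d + 1) * ε ^ 2 * decay d (ε⁻¹ • x) := by
  rw [mem_ball_zero_iff] at hx
  have h := hk.profile_le d hd hε (norm_nonneg x) hx.le
  rwa [decay, norm_smul, norm_inv, Real.norm_of_nonneg hε.le, inv_mul_eq_div]

/-- On this ball u is at least its value at radius ε, which is explicit; ε ≤ 1/2 lets ε^(-d) - 1 be
replaced by half of ε^(-d). -/
theorem IsStep.le_solution (hk : IsStep k b ε) (hd : 0 < d) (hε : 0 < ε) (hε1 : ε ≤ 1 / 2)
    (hb : ε / 2 ≤ b) (hbε : b ≤ ε) {x : EuclideanSpace ℝ (Fin (d + 2))} (hx : x ∈ ball 0 ε) :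
    (2 ^ (d + 3) * ((d : ℝ) + 2) * d)⁻¹ * ε ^ 2 ≤ solution d k x := by
  rw [mem_ball_zero_iff] at hx
  have hb0 : 0 < b := by linarith
  have hd' : (0 : ℝ) < d := by exact_mod_cast hd
  refine le_trans ?_ ((hk.profile_strictAnti d hb0).antitone
    (show ‖x‖ ^ 2 ≤ ε ^ 2 by gcongr))
  rw [hk.profile_sq_eps d hd hε (by linarith)]
  have h1 := hk.le_flux (d + 1) hb0.le hbε
  push_cast at h1
  have hεd : ε ^ d ≤ 1 / 2 := (pow_le_of_le_one hε.le (by linarith) (by omega)).trans hε1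
  have h2 : (ε ^ d)⁻¹ / 2 ≤ (ε ^ d)⁻¹ - 1 := by
    have : 2 ≤ (ε ^ d)⁻¹ := by
      rw [le_inv_comm₀ (by norm_num) (by positivity)]; linarith
    linarith
  have h3 : (ε / 2) ^ (d + 1 + 1) / ((d : ℝ) + 1 + 1) ≤ flux (d + 1) k ε := by
    refine le_trans ?_ h1
    gcongr
  have h4 : 0 < (ε ^ d)⁻¹ := by positivity
  calc (2 ^ (d + 3) * ((d : ℝ) + 2) * d)⁻¹ * ε ^ 2
      = (ε / 2) ^ (d + 1 + 1) / ((d : ℝ) + 1 + 1) / d * ((ε ^ d)⁻¹ / 2) := by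
        rw [show (d : ℝ) + 1 + 1 = d + 2 by ring, div_pow]; field_simp; ring
    _ ≤ _ := by
        have h5 : 0 ≤ flux (d + 1) k ε := le_trans (by positivity) h3
        exact mul_le_mul (by gcongr) h2 (by positivity) (by positivity)

theorem IsStep.memLp_solution (hk : IsStep k b ε) (p : ℝ≥0∞) :
    MemLp (solution d k) p (volume.restrict (ball 0 1)) := by
  have hc := hk.contDiff_solution (d := d).continuous
  obtain ⟨C, hC⟩ := (isCompact_closedBall (0 : EuclideanSpace ℝ (Fin (d + 2)))
    1).exists_bound_of_continuousOn hc.continuousOn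
  have : IsFiniteMeasure (volume.restrict (ball (0 : EuclideanSpace ℝ (Fin (d + 2))) 1)) :=
    ⟨by simpa using measure_ball_lt_top⟩
  exact MemLp.of_bound hc.aestronglyMeasurable C
    (ae_restrict_of_forall_mem measurableSet_ball fun x hx => hC x (ball_subset_closedBall hx))

theorem volume_real_ball (hε : 0 < ε) : volume.real (ball (0 : EuclideanSpace ℝ (Fin (d + 2))) ε)
    = ε ^ (d + 2) * volume.real (ball (0 : EuclideanSpace ℝ (Fin (d + 2))) 1) := by
  rw [Measure.real, Measure.addHaar_ball_of_pos _ _ hε, ENNReal.toReal_mul,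
    ENNReal.toReal_ofReal (by positivity), finrank_euclideanSpace_fin, Measure.real]

/-- The `Lᵖ` norm of the solutions grows faster than the `L^q` norm as the step concentrates. -/
theorem exists_rpow_le_normLp_div (hd : 0 < d) {p q : ℝ≥0∞} (hq : 1 ≤ q) (hqp : q < p)
    (hp : ENNReal.ofReal (((d : ℝ) + 2) / d) < p) :
    ∃ A s : ℝ, 0 < A ∧ 0 < s ∧ ∀ (ε b : ℝ) (k : ℝ → ℝ), 0 < ε → ε ≤ 1 / 2 → ε / 2 ≤ b → b ≤ ε →
      IsStep k b ε →
      A * (ε⁻¹) ^ s ≤ normLp p (ball 0 1) (solution d k) / normLp q (ball 0 1) (solution d k) := by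
  have hd' : (0 : ℝ) < d := by exact_mod_cast hd
  -- An intermediate exponent: r > N/(N-2) puts the decay profile in L^r of the whole space, r > q
  -- permits Hölder on the ball, and r < p leaves a positive power of 1/ε.
  obtain ⟨r, hr1, hrp⟩ := ENNReal.lt_iff_exists_nnreal_btwn.1 (max_lt hqp hp)
  have hqr : q < r := (le_max_left _ _).trans_lt hr1
  have hr0 : 0 < (r : ℝ) := by
    have : (1 : ℝ≥0∞) < r := hq.trans_lt hqr
    exact_mod_cast zero_lt_one.trans (ENNReal.coe_lt_coe.1 this)
  have hrN : (d : ℝ) + 2 < d * r := by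
    have h1 : ENNReal.ofReal (((d : ℝ) + 2) / d) < r := (le_max_right _ _).trans_lt hr1
    rw [ENNReal.ofReal_lt_iff_lt_toReal (by positivity) (by simp), ENNReal.coe_toReal,
      div_lt_iff₀ hd'] at h1
    linarith
  have hpr : 1 / p.toReal < 1 / (r : ℝ) := by
    rcases eq_or_ne p ⊤ with rfl | hpt
    · simpa using hr0
    · have : (r : ℝ) < p.toReal := by
        simpa using (ENNReal.toReal_lt_toReal (by simp) hpt).2 hrp
      exact one_div_lt_one_div_of_lt hr0 this
  have hp0 : p ≠ 0 := (zero_le.trans_lt hqp).ne'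
  have hq0 : q ≠ 0 := (zero_lt_one.trans_le hq).ne'
  set V := volume.real (ball (0 : EuclideanSpace ℝ (Fin (d + 2))) 1) with hV
  have hV0 : 0 < V := volume_ball_pos
  set c : ℝ := (2 ^ (d + 3) * ((d : ℝ) + 2) * d)⁻¹ with hc
  have hc0 : 0 < c := by positivity
  set K : ℝ := (eLpNorm (decay d) r volume).toReal with hK
  -- The added 1 only secures C > 0 without showing K > 0.
  set C : ℝ := 2 ^ (d + 1) * (K * V ^ (1 / q.toReal - 1 / (r : ℝ))) + 1 with hC
  have hK0 : 0 ≤ K := ENNReal.toReal_nonneg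
  have hC0 : 0 < C := by positivity
  refine ⟨c * V ^ (1 / p.toReal) / C, (d + 2) * (1 / (r : ℝ) - 1 / p.toReal), by positivity,
    mul_pos (by positivity) (by linarith), fun ε b k hε hε1 hb hbε hk => ?_⟩
  have hb0 : 0 < b := by linarith
  have hsub : ball (0 : EuclideanSpace ℝ (Fin (d + 2))) ε ⊆ ball 0 1 :=
    ball_subset_ball (by linarith)
  have hlow : ∀ t : ℝ≥0∞, t ≠ 0 → c * ε ^ 2 * (ε ^ (d + 2) * V) ^ (1 / t.toReal) ≤
      normLp t (ball 0 1) (solution d k) := fun t ht => by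
    rw [hV, ← volume_real_ball hε]
    exact mul_rpow_le_normLp ht measurableSet_ball hsub (measure_ball_pos _ _ hε).ne'
      (hk.memLp_solution t) (by positivity) fun x hx => hk.le_solution hd hε hε1 hb hbε hx
  have hqpos : 0 < normLp q (ball 0 1) (solution d k) :=
    lt_of_lt_of_le (by positivity) (hlow q hq0)
  have hupp : normLp q (ball 0 1) (solution d k) ≤ C * (ε ^ 2 * (ε ^ (d + 2)) ^ (1 / (r : ℝ))) := by
    have h1 := eLpNorm_le_eLpNorm_mul_rpow_measure_univ hqr.le
      (hk.memLp_solution (d := d) q).aestronglyMeasurable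
    have h2 : eLpNorm (solution d k) r (volume.restrict (ball 0 1))
        ≤ eLpNorm ((2 ^ (d + 1) * ε ^ 2) • fun x => decay d (ε⁻¹ • x)) r volume := by
      refine le_trans ?_ (eLpNorm_mono_measure _
        (Measure.restrict_le_self (s := ball 0 1)))
      refine eLpNorm_mono_ae (ae_restrict_of_forall_mem measurableSet_ball fun x hx => ?_)
      rw [Real.norm_of_nonneg (hk.solution_nonneg hb0 hx)]
      exact (hk.solution_le hd hε hx).trans (Real.le_norm_self _)
    rw [eLpNorm_const_smul, eLpNorm_decay_scaled d r hε] at h2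
    have hfin := (eLpNorm_decay_lt_top d hrN).ne
    have h3 := h1.trans (mul_le_mul_left h2 _)
    have hexp : 0 ≤ 1 / q.toReal - 1 / (r : ℝ) := by
      have : q.toReal ≤ r := by
        simpa using (ENNReal.toReal_le_toReal (hqr.trans (by simp)).ne (by simp)).2 hqr.le
      rw [sub_nonneg]
      exact one_div_le_one_div_of_le (ENNReal.toReal_pos hq0 (hqr.trans (by simp)).ne) this
    rw [Measure.restrict_apply_univ, ENNReal.coe_toReal] at h3
    have h4 := ENNReal.toReal_mono (by
      refine ENNReal.mul_ne_top (ENNReal.mul_ne_top enorm_ne_top (ENNReal.mul_ne_top ?_ hfin)) ?_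
      · exact (ENNReal.rpow_lt_top_of_nonneg (by positivity) (by simp)).ne
      · exact (ENNReal.rpow_lt_top_of_nonneg hexp measure_ball_lt_top.ne).ne) h3
    rw [ENNReal.toReal_mul, ENNReal.toReal_mul, ENNReal.toReal_mul, ← ENNReal.toReal_rpow,
      ← ENNReal.toReal_rpow, toReal_enorm, ENNReal.toReal_ofReal (by positivity),
      Real.norm_of_nonneg (by positivity)] at h4
    refine le_trans h4 ?_
    change _ * (_ * K) * V ^ _ ≤ _
    have h5 : 0 ≤ ε ^ 2 * (ε ^ (d + 2)) ^ (1 / (r : ℝ)) := by positivity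
    rw [hC]
    linarith
  have hsplit : (ε ^ (d + 2)) ^ (1 / p.toReal)
      = (ε ^ (d + 2)) ^ (1 / (r : ℝ)) * ε⁻¹ ^ ((d + 2) * (1 / (r : ℝ) - 1 / p.toReal)) := by
    rw [← Real.rpow_natCast, ← Real.rpow_mul hε.le, ← Real.rpow_mul hε.le, Real.inv_rpow hε.le,
      ← Real.rpow_neg hε.le, ← Real.rpow_add hε]
    congr 1
    push_cast
    ring
  rw [le_div_iff₀ hqpos]
  refine le_trans ?_ (hlow p hp0)
  rw [Real.mul_rpow (by positivity) hV0.le, hsplit]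
  calc _ ≤ c * V ^ (1 / p.toReal) / C * ε⁻¹ ^ ((d + 2) * (1 / (r : ℝ) - 1 / p.toReal))
        * (C * (ε ^ 2 * (ε ^ (d + 2)) ^ (1 / (r : ℝ)))) := by gcongr
    _ = _ := by field_simp

end RadialMorse
end

/-! ### The concentrating sequence ε = 1/(n + 50) -/

theorem theorem2p1 (N : ℕ) (hN3 : 3 ≤ N) (hN9 : N ≤ 9) (p q : ℝ≥0∞) (hq : 1 ≤ q) (hqp : q < p)
    (hp : ENNReal.ofReal ((N : ℝ) / ((N : ℝ) - 2)) < p) :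
    ∃ (u : ℕ → EuclideanSpace ℝ (Fin N) → ℝ) (f : ℕ → ℝ → ℝ),
      (∀ n, ContDiffOn ℝ ∞ (u n) (closedBall 0 1) ∧
        RadialMorse.IsRadialOn (u n) (closedBall 0 1) ∧
        ContDiff ℝ ∞ (f n) ∧ (∀ t, 0 ≤ f n t) ∧ Monotone (f n) ∧
        RadialMorse.SolvesDirichlet (ball 0 1) (f n) (u n) ∧
        RadialMorse.HasRadialMorseIndex (ball 0 1) (f n) (u n) 1) ∧
      Tendsto (fun n => RadialMorse.normLp p (ball 0 1) (u n) /
        RadialMorse.normLp q (ball 0 1) (u n)) atTop atTop := by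
  obtain ⟨d, rfl⟩ : ∃ d, N = d + 2 := ⟨N - 2, by omega⟩
  have hd : 0 < d := by omega
  rw [Nat.cast_add, Nat.cast_ofNat, add_sub_cancel_right] at hp
  obtain ⟨A, s, hA, hs, hAs⟩ := RadialMorse.exists_rpow_le_normLp_div hd hq hqp hp
  have hε (n : ℕ) : 0 < ((n : ℝ) + 50)⁻¹ := by positivity
  have hε1 (n : ℕ) : ((n : ℝ) + 50)⁻¹ ≤ 1 / 50 := by
    rw [inv_eq_one_div]
    exact one_div_le_one_div_of_le (by norm_num) (by linarith [(Nat.cast_nonneg n : (0 : ℝ) ≤ n)])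
  have hb (n : ℕ) : 0 < 999 / 1000 * ((n : ℝ) + 50)⁻¹ := by positivity
  choose k hk using fun n : ℕ => RadialMorse.exists_isStep (hb n).le
    (show 999 / 1000 * ((n : ℝ) + 50)⁻¹ < ((n : ℝ) + 50)⁻¹ by linarith [hε n])
  refine ⟨fun n => RadialMorse.solution d (k n),
    fun n => RadialMorse.nonlinearity d (k n) ((n : ℝ) + 50)⁻¹, fun n => ⟨?_, ?_, ?_, ?_, ?_, ?_, ?_⟩,
    ?_⟩
  · exact (hk n).contDiff_solution.contDiffOn
  · intro x _ y _ hxy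
    simp only [RadialMorse.solution, hxy]
  · exact (hk n).contDiff_nonlinearity d (hb n)
  · exact (hk n).nonlinearity_nonneg d
  · exact (hk n).nonlinearity_mono d (hb n)
  · exact (hk n).solvesDirichlet (hb n)
  · exact (hk n).hasRadialMorseIndex hd (by omega) (hε n) (hε1 n) rfl
  · refine tendsto_atTop_mono (fun n => hAs ((n : ℝ) + 50)⁻¹ _ (k n) (hε n)
      ((hε1 n).trans (by norm_num)) (by linarith [hε n]) (by linarith [hε n]) (hk n)) ?_
    simp only [inv_inv]
    exact ((tendsto_rpow_atTop hs).comp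
      (tendsto_atTop_add_const_right _ 50 tendsto_natCast_atTop_atTop)).const_mul_atTop hA
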